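/- All spaces are Hausdorff. For a space \(X\), let \(\mathscr F(X)\) be the set of all nonempty closed subsets of \(X\) with the Vietoris topology, generated by the sets \(\{S: S\subset\bigcup_{i\le n}V_i,\ S\cap V_i\ne\emptyset\ (i\le n)\}\) with \(V_1,\dots,V_n\subset X\) open. A continuous selection is a continuous map \(f:\mathscr F(X)\to X\) with \(f(S)\in S\) for all \(S\); it is \(p\)-maximal if \(f(S)=p\) whenever \(p\in S\). \(X\) is selection pointwise-maximal if for every \(p\in X\) there is a \(p\)-maximal continuous selection for \(\mathscr F(X)\). A nonempty closed set \(H\subset X\) is clopen modulo a point \(q\in H\) if \(H\setminus\{q\}\) is open in \(X\); \(\Delta(X)\) is the family of all such sets (for some \(q\)), and \(\Delta_\omega(X)\) consists of those \(H\in\Delta(X)\) which are clopen or are clopen modulo a point \(q\in H\) at which the subspace \(H\) has a countable local base. A neighbourhood of a set \(T\) is a set containing \(T\) in its interior, and a neighbourhood base at \(T\) is a family of neighbourhoods of \(T\) such that every neighbourhood of \(T\) contains one of them. \(X\) is pointwise well-orderable if at every point \(p\) it has a \(\gamma\)-base for some regular cardinal \(\gamma\) (infinite regular, or \(\gamma=1\)),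 i.e. a neighbourhood base \(\{H_\alpha:\alpha<\gamma\}\subset\Delta_\omega(X)\) at \(p\) such that \(H_{\alpha+1}\) is clopen and \(H_{\alpha+1}\subsetneq H_\alpha\) whenever \(\alpha+1<\gamma\), and \(\{H_\alpha:\alpha<\lambda\}\) is a neighbourhood base at \(H_\lambda\) for every limit ordinal \(\lambda\) with \(0<\lambda<\gamma\). An ordinal decomposition of \(X\) is a partition \(\mathscr D\subset\Delta(X)\) of \(X\) into nonempty sets which is upper semi-continuous (for every \(D\in\mathscr D\) and every open \(U\supset D\) there is an open \(V\) with \(D\subset V\subset U\) that is a union of members of \(\mathscr D\)) and whose decomposition space, i.e. \(\mathscr D\) with the quotient topology, is homeomorphic to a compact ordinal space \([0,\gamma]\) for some ordinal \(\gamma\). **Theorem.** Let \(X\) be a Hausdorff space for which \(\mathscr F(X)\) has a continuous selection. The following are equivalent: (a) \(X\) is selection pointwise-maximal; (b) \(X\) is pointwise well-orderable; (c) for every \(p\in X\), \(X\) has an ordinal decomposition \(\mathscr D\subset\Delta_\omega(X)\) with \(\{p\}\in\mathscr D\). -/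

import Mathlib

open Set Topology

namespace OrdDec

/-- `𝓕(X)`: the set of all nonempty closed subsets of `X`. -/
def Hyperspace (X : Type*) [TopologicalSpace X] : Type _ :=
  {S : Set X // S.Nonempty ∧ IsClosed S}

/-- The Vietoris topology on `𝓕(X)`. -/
instance instTopologicalSpaceHyperspace (X : Type*) [TopologicalSpace X] :
    TopologicalSpace (Hyperspace X) :=
  TopologicalSpace.induced (fun S : Hyperspace X => S.1) (TopologicalSpace.vietoris X)

section

variable {X : Type*} [TopologicalSpace X]

/-- `f` is a Vietoris continuous selection for `𝓕(X)`. -/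
def IsContinuousSelection (f : Hyperspace X → X) : Prop :=
  Continuous f ∧ ∀ S : Hyperspace X, f S ∈ S.1

/-- The point `p` is selection-maximal: some continuous selection `f` for `𝓕(X)` is `p`-maximal,
i.e. `f S = p` for every nonempty closed `S` containing `p`. -/
def IsSelectionMaximal (p : X) : Prop :=
  ∃ f : Hyperspace X → X, IsContinuousSelection f ∧ ∀ S : Hyperspace X, p ∈ S.1 → f S = p

/-- `H` is clopen modulo the point `p`. -/
def IsClopenModuloAt (H : Set X) (p : X) : Prop :=
  IsClosed H ∧ p ∈ H ∧ IsOpen (H \ {p})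

/-- `Δ(X)`: the nonempty closed sets which are clopen modulo some point (of the set). -/
def Delta (X : Type*) [TopologicalSpace X] : Set (Set X) :=
  {H | ∃ p, IsClopenModuloAt H p}

/-- `Δ_ω(X)`: the members `H` of `Δ(X)` which are clopen, or clopen modulo a point `q ∈ H` at which
the subspace `H` has a countable local base. -/
def DeltaOmega (X : Type*) [TopologicalSpace X] : Set (Set X) :=
  {H | H ∈ Delta X ∧ (IsClopen H ∨
    ∃ q, ∃ hq : q ∈ H, IsClopenModuloAt H q ∧ (𝓝 (⟨q, hq⟩ : H)).IsCountablyGenerated)}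

/-- A partition `𝓓` of `X` is upper semi-continuous if every neighbourhood of a member contains a
saturated open neighbourhood of that member. -/
def IsUpperSemicontinuousDecomposition (𝓓 : Set (Set X)) : Prop :=
  Setoid.IsPartition 𝓓 ∧ ∀ A ∈ 𝓓, ∀ U : Set X, IsOpen U → A ⊆ U →
    ∃ V : Set X, IsOpen V ∧ A ⊆ V ∧ V ⊆ U ∧ ∃ 𝓔 ⊆ 𝓓, V = ⋃₀ 𝓔

/-- The decomposition space of a partition: its set of classes with the quotient topology. -/
abbrev DecompositionSpace (𝓓 : Set (Set X)) (h : Setoid.IsPartition 𝓓) : Type _ :=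
  Quotient (Setoid.mkClasses 𝓓 h.2)

end

section

universe u

variable {X : Type u} [TopologicalSpace X]

/-- `𝓓 ⊆ Δ(X)` is an ordinal decomposition of `X`: an upper semi-continuous decomposition whose
decomposition space is homeomorphic to a compact ordinal space `[0, γ]`. (The space `[0, γ]` is in
bijection with `𝓓`, so ordinals of the universe of `X` suffice.) -/
def IsOrdinalDecomposition (𝓓 : Set (Set X)) : Prop :=
  𝓓 ⊆ Delta X ∧ IsUpperSemicontinuousDecomposition 𝓓 ∧
    ∃ (h : Setoid.IsPartition 𝓓) (γ : Ordinal.{u}),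
      Nonempty (DecompositionSpace 𝓓 h ≃ₜ Set.Iic γ)

/-- The family `(H α)`, `α < γ`, is a `γ`-base at `p`; values of `H` outside `[0, γ)` play no
role. -/
structure IsGammaBase (γ : Cardinal.{u}) (H : Ordinal.{u} → Set X) (p : X) : Prop where
  mem_deltaOmega : ∀ α < γ.ord, H α ∈ DeltaOmega X
  hasBasis : (𝓝 p).HasBasis (fun α => α < γ.ord) H
  isClopen_succ : ∀ α, Order.succ α < γ.ord → IsClopen (H (Order.succ α))
  ssubset_succ : ∀ α, Order.succ α < γ.ord → H (Order.succ α) ⊂ H α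
  hasBasis_limit : ∀ l < γ.ord, Order.IsSuccLimit l →
    (𝓝ˢ (H l)).HasBasis (fun α => α < l) H

/-- `X` is well-orderable at `p`: it has a `γ`-base at `p` for a regular cardinal `γ`. The finite
cardinal `1`, which equals its own cofinality, is allowed; it is the one that occurs at isolated
points. -/
def IsWellOrderableAt (p : X) : Prop :=
  ∃ (γ : Cardinal.{u}) (H : Ordinal.{u} → Set X),
    (γ = 1 ∨ γ.IsRegular) ∧ IsGammaBase γ H p

end

/-- Every point of `X` is selection-maximal. -/
def SelectionPointwiseMaximal (X : Type*) [TopologicalSpace X] : Prop :=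
  ∀ p : X, IsSelectionMaximal p

/-- `X` is well-orderable at each of its points. -/
def PointwiseWellOrderable (X : Type*) [TopologicalSpace X] : Prop :=
  ∀ p : X, IsWellOrderableAt p

end OrdDec

/-! Everything in (a) → (b) comes from adding a point `x` to a closed set `S` and asking whether the
selection picks `x`. The points newly picked form an open set whose closure gains at most the point
`f S`. That point has a maximal selection of its own, which helps to cut it off, so `X` is
zero-dimensional. Now shrink clopen neighbourhoods of `p` transfinitely so that points of later sets
are picked when added to the complements of earlier ones. At a limit stage, nets of such points
outside the interior of the intersection all converge to one value: the intersection has a single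
boundary point `q` and the earlier stages form a base at it (`exists_boundary_point`). If `q` is
approached from both sides it is a cut point, and its maximal selection yields a countable base
there (`exists_iInter_eq_singleton`, `isCountablyGenerated_nhds`).

For (b) → (c), send a point to the stage at which it leaves the base at `p`. This is a closed
continuous map onto a compact ordinal, and its fibres are the decomposition.

For (c) → (a), the decomposition is a continuous ordinal rank that attains its maximum on closed
sets. Inside the top class of `S`, countability of the local base gives an exhaustion by clopen sets
up to one point; the given selection is applied to the trace of `S` on the first of them that `S`
meets (`exists_isContinuousSelection`). Discarding ranks above that of `p` makes the selection
`p`-maximal. -/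

namespace OrdDec

open Filter

/-! ### Convergence and continuous operations in the Vietoris topology -/

section Vietoris

variable {X : Type*} [TopologicalSpace X]

namespace Hyperspace

theorem isOpen_subset {U : Set X} (hU : IsOpen U) : IsOpen {S : Hyperspace X | S.1 ⊆ U} := by
  let _ := TopologicalSpace.vietoris X
  exact isOpen_induced hU.powerset_vietoris

theorem isOpen_meets {U : Set X} (hU : IsOpen U) :
    IsOpen {S : Hyperspace X | (S.1 ∩ U).Nonempty} := by
  let _ := TopologicalSpace.vietoris X
  exact isOpen_induced (TopologicalSpace.vietoris.isOpen_inter_nonempty_of_isOpen hU)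

theorem tendsto_nhds {ι : Type*} {l : Filter ι} {E : ι → Hyperspace X} {S : Hyperspace X}
    (h₁ : ∀ U, IsOpen U → S.1 ⊆ U → ∀ᶠ i in l, (E i).1 ⊆ U)
    (h₂ : ∀ U, IsOpen U → (S.1 ∩ U).Nonempty → ∀ᶠ i in l, ((E i).1 ∩ U).Nonempty) :
    Tendsto E l (𝓝 S) := by
  let _ := TopologicalSpace.vietoris X
  rw [nhds_induced, tendsto_comap_iff]
  refine TopologicalSpace.tendsto_nhds_generateFrom_iff.2 ?_
  rintro _ (⟨U, hU, rfl⟩ | ⟨U, hU, rfl⟩) hS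
  · exact h₁ U hU hS
  · exact h₂ U hU hS

/-- Convergence to a set from inside. -/
theorem tendsto_nhds_of_subset {ι : Type*} {l : Filter ι} {E : ι → Hyperspace X}
    {S : Hyperspace X} (h₁ : ∀ᶠ i in l, (E i).1 ⊆ S.1)
    (h₂ : ∀ U, IsOpen U → (S.1 ∩ U).Nonempty → ∀ᶠ i in l, ((E i).1 ∩ U).Nonempty) :
    Tendsto E l (𝓝 S) :=
  tendsto_nhds (fun _ _ hSU => h₁.mono fun _ hi => hi.trans hSU) h₂

/-- The closed set `F ∪ {x}`. -/
def addPoint [T1Space X] (F : Set X) (hF : IsClosed F) (x : X) : Hyperspace X :=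
  ⟨insert x F, insert_nonempty x F, by
    rw [insert_eq]; exact isClosed_singleton.union hF⟩

theorem continuous_addPoint [T1Space X] (F : Set X) (hF : IsClosed F) :
    Continuous (addPoint F hF) := by
  refine continuous_iff_continuousAt.2 fun x => tendsto_nhds (fun U hU hS => ?_) fun U hU hS => ?_
  · obtain ⟨hx, hFU⟩ := insert_subset_iff.1 hS
    filter_upwards [hU.mem_nhds hx] with y hy
    exact insert_subset hy hFU
  · obtain ⟨z, rfl | hz, hzU⟩ := hS
    · filter_upwards [hU.mem_nhds hzU] with y hy
      exact ⟨y, mem_insert _ _, hy⟩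
    · exact Eventually.of_forall fun y => ⟨z, mem_insert_of_mem _ hz, hzU⟩

theorem addPoint_of_mem [T1Space X] (S : Hyperspace X) {x : X} (hx : x ∈ S.1) :
    addPoint S.1 S.2.2 x = S :=
  Subtype.ext (insert_eq_of_mem hx)

/-- The trace of a closed set on the closed set `D` if this is nonempty, and the set itself
otherwise. -/
noncomputable def trace (D : Set X) (hD : IsClosed D) (S : Hyperspace X) : Hyperspace X :=
  open Classical in if h : (S.1 ∩ D).Nonempty then ⟨S.1 ∩ D, h, S.2.2.inter hD⟩ else S

theorem trace_val {D : Set X} (hD : IsClosed D) {S : Hyperspace X} (h : (S.1 ∩ D).Nonempty) :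
    (trace D hD S).1 = S.1 ∩ D := by
  exact congrArg Subtype.val (dif_pos h : trace D hD S = _)

theorem trace_of_disjoint {D : Set X} (hD : IsClosed D) {S : Hyperspace X}
    (h : ¬ (S.1 ∩ D).Nonempty) : trace D hD S = S := by
  exact dif_neg h

theorem trace_subset {D : Set X} (hD : IsClosed D) (S : Hyperspace X) :
    (trace D hD S).1 ⊆ S.1 := by
  by_cases h : (S.1 ∩ D).Nonempty
  · rw [trace_val hD h]; exact inter_subset_left
  · rw [trace_of_disjoint hD h]

theorem continuous_trace {D : Set X} (hD : IsClopen D) : Continuous (trace D hD.1) := by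
  refine continuous_iff_continuousAt.2 fun S => ?_
  by_cases h : (S.1 ∩ D).Nonempty
  · have hev : ∀ᶠ T : Hyperspace X in 𝓝 S, (T.1 ∩ D).Nonempty :=
      (isOpen_meets hD.2).mem_nhds h
    refine tendsto_nhds (fun U hU hS => ?_) fun U hU hS => ?_
    · rw [trace_val _ h] at hS
      have h1 : ∀ᶠ T : Hyperspace X in 𝓝 S, T.1 ⊆ U ∪ Dᶜ := by
        refine (isOpen_subset (hU.union hD.1.isOpen_compl)).mem_nhds fun x hx => ?_
        by_cases hxD : x ∈ D
        · exact Or.inl (hS ⟨hx, hxD⟩)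
        · exact Or.inr hxD
      filter_upwards [hev, h1] with T hT hTU
      rw [trace_val _ hT]
      exact fun x hx => (hTU hx.1).resolve_right fun h => h hx.2
    · rw [trace_val _ h] at hS
      have h1 : ∀ᶠ T : Hyperspace X in 𝓝 S, (T.1 ∩ (D ∩ U)).Nonempty :=
        (isOpen_meets (hD.2.inter hU)).mem_nhds 
          (let ⟨x, hx, hxU⟩ := hS; ⟨x, hx.1, hx.2, hxU⟩)
      filter_upwards [hev, h1] with T hT hTU
      rw [trace_val _ hT, inter_assoc]
      exact hTU
  · have h1 : ∀ᶠ T : Hyperspace X in 𝓝 S, T.1 ⊆ Dᶜ :=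
      (isOpen_subset hD.1.isOpen_compl).mem_nhds fun x hx hxD => h ⟨x, hx, hxD⟩
    have h2 : ∀ T : Hyperspace X, T.1 ⊆ Dᶜ → trace D hD.1 T = T := fun T hT =>
      trace_of_disjoint _ fun ⟨x, hx, hxD⟩ => hT hx hxD
    have h3 : trace D hD.1 =ᶠ[𝓝 S] id := h1.mono h2
    exact continuousAt_id.congr h3.symm

end Hyperspace

end Vietoris

open Hyperspace

/-- The selection `f` is `p`-maximal. -/
def IsMaximalSelectionAt {X : Type*} [TopologicalSpace X] (f : Hyperspace X → X) (p : X) : Prop :=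
  IsContinuousSelection f ∧ ∀ S : Hyperspace X, p ∈ S.1 → f S = p

/-! ### Zero-dimensionality from maximal selections -/

section ZeroDim

variable {X : Type*} [TopologicalSpace X] [T2Space X] {f : Hyperspace X → X}

theorem IsContinuousSelection.addPoint_eq_or (hf : IsContinuousSelection f) (F : Set X)
    (hF : IsClosed F) (x : X) : f (addPoint F hF x) = x ∨ f (addPoint F hF x) ∈ F :=
  mem_insert_iff.1 (hf.2 (addPoint F hF x))

theorem IsContinuousSelection.continuous_addPoint (hf : IsContinuousSelection f) (F : Set X)
    (hF : IsClosed F) : Continuous fun x => f (addPoint F hF x) :=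
  hf.1.comp (Hyperspace.continuous_addPoint F hF)

/-- The points which are selected when added to `S`. -/
def newPoints (f : Hyperspace X → X) (S : Hyperspace X) : Set X :=
  {x | f (addPoint S.1 S.2.2 x) ∉ S.1}

theorem isOpen_newPoints (hf : IsContinuousSelection f) (S : Hyperspace X) :
    IsOpen (newPoints f S) :=
  S.2.2.isOpen_compl.preimage (hf.continuous_addPoint S.1 S.2.2)

theorem apply_addPoint_of_mem_newPoints (hf : IsContinuousSelection f) {S : Hyperspace X} {x : X}
    (hx : x ∈ newPoints f S) : f (addPoint S.1 S.2.2 x) = x :=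
  (hf.addPoint_eq_or _ _ x).resolve_right hx

theorem newPoints_subset_compl (hf : IsContinuousSelection f) (S : Hyperspace X) :
    newPoints f S ⊆ S.1ᶜ := fun x hx hxS => by
  refine hx ?_
  rwa [apply_addPoint_of_mem_newPoints hf hx]

theorem mem_newPoints {p : X} (hf : IsMaximalSelectionAt f p) {S : Hyperspace X}
    (hp : p ∉ S.1) : p ∈ newPoints f S := by
  change f (addPoint S.1 S.2.2 p) ∉ S.1
  rwa [hf.2 _ (mem_insert _ _)]

/-- The equation `f (S ∪ {x}) = x` passes to limits. A limit point that is not new therefore lies in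
`S`, where adding it changes nothing, and so it equals `f S`. -/
theorem closure_newPoints_subset (hf : IsContinuousSelection f) (S : Hyperspace X) :
    closure (newPoints f S) ⊆ insert (f S) (newPoints f S) := by
  intro x hx
  by_cases hxG : x ∈ newPoints f S
  · exact Or.inr hxG
  have h1 : f (addPoint S.1 S.2.2 x) = x :=
    closure_minimal (t := {x | f (addPoint S.1 S.2.2 x) = x})
      (fun y hy => apply_addPoint_of_mem_newPoints hf hy)
      (isClosed_eq (hf.continuous_addPoint _ _) continuous_id) hx
  have h2 : x ∈ S.1 := by
    have := not_not.1 hxG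
    rwa [h1] at this
  rw [addPoint_of_mem S h2] at h1
  exact Or.inl h1.symm

theorem IsMaximalSelectionAt.apply_pair {p : X} (hf : IsMaximalSelectionAt f p) (b : X) :
    f (addPoint {b} isClosed_singleton p) = p :=
  hf.2 _ (mem_insert _ _)

theorem apply_addPoint_comm (f : Hyperspace X → X) (a b : X) :
    f (addPoint {a} isClosed_singleton b) = f (addPoint {b} isClosed_singleton a) :=
  congrArg f (Subtype.ext (pair_comm b a))

/-- If `q` is not interior to `G ∪ {q}`, some `b` outside is so close to `q` that `f {p, b} = b`.
The condition `f {x, b} = b` then cuts a clopen piece out of `G`: it is closed because it fails at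
`q`, and open because for `x ∈ G` it says that the value avoids the closed set `G ∪ {q}`. -/
theorem exists_isClopen_subset_or_isClopen_insert {p q : X} (hf : IsMaximalSelectionAt f q)
    {G : Set X} (hG : IsOpen G) (hp : p ∈ G) (hq : q ∉ G) (hcl : closure G ⊆ insert q G) :
    (∃ C, IsClopen C ∧ p ∈ C ∧ C ⊆ G) ∨ IsClopen (insert q G) := by
  have hY : IsClosed (insert q G) := by
    have : insert q G = closure G ∪ {q} :=
      Subset.antisymm (insert_subset (Or.inr rfl) fun x hx => Or.inl (subset_closure hx))
        (union_subset hcl (singleton_subset_iff.2 (mem_insert _ _)))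
    rw [this]
    exact isClosed_closure.union isClosed_singleton
  by_cases hqB : q ∈ closure (insert q G)ᶜ
  · left
    have hpq : q ≠ p := fun h => hq (h ▸ hp)
    have h1 : ∀ᶠ x in 𝓝 q, f (addPoint {p} isClosed_singleton x) ≠ p :=
      (hf.1.continuous_addPoint _ _).continuousAt.eventually_ne (by rwa [hf.apply_pair p])
    obtain ⟨b, hbp, hb⟩ := (mem_closure_iff_nhds.1 hqB _ h1)
    have hb1 : f (addPoint {p} isClosed_singleton b) = b :=
      (hf.1.addPoint_eq_or _ _ b).resolve_right hbp
    rw [apply_addPoint_comm f] at hb1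
    have hbG : b ∉ G := fun h => hb (Or.inr h)
    have hbq : q ≠ b := fun h => hb (Or.inl h.symm)
    have hcont := hf.1.continuous_addPoint {b} isClosed_singleton
    refine ⟨G ∩ {x | f (addPoint {b} isClosed_singleton x) = b}, ⟨?_, ?_⟩, ⟨hp, hb1⟩,
      inter_subset_left⟩
    · refine closure_subset_iff_isClosed.1 fun x hx => ?_
      have hxb : f (addPoint {b} isClosed_singleton x) = b :=
        closure_minimal inter_subset_right (isClosed_eq hcont continuous_const) hx
      refine ⟨(hcl (closure_mono inter_subset_left hx)).resolve_left fun hxq => hbq ?_, hxb⟩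
      rw [← hxb, hxq, hf.apply_pair]
    · have : G ∩ {x | f (addPoint {b} isClosed_singleton x) = b} =
          G ∩ (fun x => f (addPoint {b} isClosed_singleton x)) ⁻¹' (insert q G)ᶜ := by
        ext x
        refine and_congr_right fun hx => ⟨fun h => ?_, fun h => ?_⟩
        · change f _ ∉ _
          rw [show f _ = b from h]; exact hb
        · refine mem_singleton_iff.1 ((hf.1.addPoint_eq_or {b} isClosed_singleton x).resolve_left
            fun hxx => h ?_)
          simp only [hxx]
          exact Or.inr hx
      rw [this]
      exact hG.inter (hY.isOpen_compl.preimage hcont)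
  · right
    refine ⟨hY, isOpen_iff_mem_nhds.2 ?_⟩
    rintro x (rfl | hx)
    · simpa [mem_closure_iff_nhds, mem_interior_iff_mem_nhds, closure_compl] using hqB
    · exact mem_of_superset (hG.mem_nhds hx) (subset_insert _ _)

/-- Selection pointwise-maximal spaces are zero-dimensional. -/
theorem SelectionPointwiseMaximal.exists_isClopen (hX : SelectionPointwiseMaximal X) {p : X}
    {U : Set X} (hU : U ∈ 𝓝 p) : ∃ C, IsClopen C ∧ p ∈ C ∧ C ⊆ U := by
  obtain ⟨V, hVU, hV, hpV⟩ := mem_nhds_iff.1 hU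
  obtain ⟨f, hf⟩ : ∃ f, IsMaximalSelectionAt f p := hX p
  rcases (Vᶜ).eq_empty_or_nonempty with hne | hne
  · exact ⟨univ, isClopen_univ, trivial, by rwa [← compl_empty_iff.1 hne]⟩
  let S : Hyperspace X := ⟨Vᶜ, hne, hV.isClosed_compl⟩
  set q := f S with hq
  have hqS : q ∈ S.1 := hf.1.2 S
  have hqG : q ∉ newPoints f S := fun h => newPoints_subset_compl hf.1 S h hqS
  have hpG : p ∈ newPoints f S := mem_newPoints hf fun h => h hpV
  have hGU : newPoints f S ⊆ U := fun x hx =>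
    hVU (not_not.1 (newPoints_subset_compl hf.1 S hx))
  obtain ⟨h, hh⟩ : ∃ h, IsMaximalSelectionAt h q := hX q
  rcases exists_isClopen_subset_or_isClopen_insert hh (isOpen_newPoints hf.1 S) hpG hqG
    (closure_newPoints_subset hf.1 S) with ⟨C, hC, hpC, hCG⟩ | hY
  · exact ⟨C, hC, hpC, hCG.trans hGU⟩
  -- The clopen set `G ∪ {q}` can leave `U` only at `q`. A point `a` picked over `q` takes its
  -- place: the new points for `{q, a}` omit `q`, and their closure gains at most `a`, which lies in
  -- `U`. If there is no such `a`, then `p` is the only point of the clopen set picked over `q`,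
  -- hence isolated.
  by_cases ha : ∃ a ∈ newPoints f S, a ≠ p ∧ f (addPoint {q} isClosed_singleton a) = a
  · obtain ⟨a, haG, hap, haq⟩ := ha
    let T := addPoint {q} isClosed_singleton a
    have hpT : p ∉ T.1 := by
      rintro (h | h)
      · exact hap h.symm
      · exact hqG (h ▸ hpG)
    have hsub : insert q (newPoints f S) ∩ newPoints f T ⊆ newPoints f S := fun x hx =>
      hx.1.resolve_left fun hxq => newPoints_subset_compl hf.1 T hx.2 (Or.inr hxq)
    have hcl : closure (insert q (newPoints f S) ∩ newPoints f T) ⊆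
        insert a (insert q (newPoints f S) ∩ newPoints f T) := fun x hx => by
      have h1 := closure_minimal inter_subset_left hY.1 hx
      have h2 := closure_newPoints_subset hf.1 T (closure_mono inter_subset_right hx)
      rw [show f T = a from haq] at h2
      exact h2.imp id fun h => ⟨h1, h⟩
    obtain ⟨k, hk⟩ : ∃ k, IsMaximalSelectionAt k a := hX a
    rcases exists_isClopen_subset_or_isClopen_insert (p := p)
      (G := insert q (newPoints f S) ∩ newPoints f T) hk (hY.2.inter (isOpen_newPoints hf.1 T))
      ⟨Or.inr hpG, mem_newPoints hf hpT⟩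
      (fun h => newPoints_subset_compl hf.1 T h.2 (Or.inl rfl)) hcl with ⟨C, hC, hpC, hCG⟩ | hC
    · exact ⟨C, hC, hpC, (hCG.trans hsub).trans hGU⟩
    · exact ⟨_, hC, Or.inr ⟨Or.inr hpG, mem_newPoints hf hpT⟩,
        insert_subset (hGU haG) (hsub.trans hGU)⟩
  · push Not at ha
    have hp : {p} = insert q (newPoints f S) ∩
        (fun x => f (addPoint {q} isClosed_singleton x)) ⁻¹' {q}ᶜ := by
      refine Subset.antisymm ?_ ?_
      · rintro _ rfl
        refine ⟨Or.inr hpG, fun h => hqG ?_⟩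
        rw [← (hf.apply_pair q).symm.trans h]
        exact hpG
      · rintro x ⟨rfl | hx, hxq⟩
        · exact absurd (or_self_iff.1 (hf.1.addPoint_eq_or _ isClosed_singleton q)) hxq
        · by_contra hxp
          exact ha x hx hxp ((hf.1.addPoint_eq_or _ _ x).resolve_right hxq)
    refine ⟨{p}, ⟨isClosed_singleton, ?_⟩, rfl, singleton_subset_iff.2 (hGU hpG)⟩
    rw [hp]
    exact hY.2.inter (isOpen_compl_singleton.preimage (hf.1.continuous_addPoint _ _))

end ZeroDim

/-! ### Boundary points of decreasing intersections, and cut points -/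

section Limits

variable {X : Type*} [TopologicalSpace X] [T2Space X] {f : Hyperspace X → X}

/-- The intersection of a decreasing family of sets whose points remain selected when added to the
complement of a larger member is clopen modulo a single boundary point, and the family is a base
at the intersection. -/
theorem IsContinuousSelection.exists_boundary_point {ι : Type*} [LinearOrder ι] [Nonempty ι]
    [NoMaxOrder ι] (hf : IsContinuousSelection f) {H : ι → Set X}
    (hss : ∀ i j, i < j → H j ⊂ H i) (hcl : ∀ i j, i < j → closure (H j) ⊆ interior (H i))
    (hadd : ∀ i j, i < j → ∀ x ∈ H j, f (addPoint (closure (H i)ᶜ) isClosed_closure x) = x) :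
    ∃ q ∈ ⋂ i, H i, IsClosed (⋂ i, H i) ∧ IsOpen ((⋂ i, H i) \ {q}) ∧
      q ∈ closure (⋂ i, H i)ᶜ ∧ ∀ O, IsOpen O → ⋂ i, H i ⊆ O → ∃ i, H i ⊆ O := by
  set K := ⋂ i, H i with hK
  choose s hs using fun i : ι => exists_gt i
  have hanti : ∀ i j, i ≤ j → H j ⊆ H i := fun i j hij => by
    rcases hij.eq_or_lt with rfl | h
    · exact Subset.rfl
    · exact (hss i j h).subset
  have hKc : K = ⋂ i, closure (H i) := by
    refine Subset.antisymm (iInter_mono fun i => subset_closure) fun x hx => mem_iInter.2 fun i => ?_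
    exact interior_subset (hcl i (s i) (hs i) (mem_iInter.1 hx (s i)))
  have hKclosed : IsClosed K := by
    rw [hKc]
    exact isClosed_iInter fun i => isClosed_closure
  have hne : ∀ i, ∃ x, x ∈ H (s i) ∧ x ∉ K := fun i => by
    obtain ⟨x, hx, hx'⟩ := exists_of_ssubset (hss (s i) (s (s i)) (hs _))
    exact ⟨x, hx, fun h => hx' (mem_iInter.1 h _)⟩
  let E : Hyperspace X := ⟨closure Kᶜ, by
    obtain ⟨x, -, hx⟩ := hne (Classical.arbitrary ι)
    exact ⟨x, subset_closure hx⟩, isClosed_closure⟩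
  -- The sets `closure (H i)ᶜ ∪ {x i}` converge to `E` from inside and `f` picks `x i` from each, so
  -- all these nets share the limit `f E`. Constant nets will show that `K` has no other boundary
  -- point.
  have key : ∀ x : ι → X, (∀ i, x i ∈ closure Kᶜ) → (∀ i, x i ∈ H (s i)) →
      Tendsto x atTop (𝓝 (f E)) := fun x hxK hxH => by
    have h1 : Tendsto (fun i => addPoint (closure (H i)ᶜ) isClosed_closure (x i)) atTop (𝓝 E) := by
      refine tendsto_nhds_of_subset (Eventually.of_forall fun i => insert_subset (hxK i) ?_) ?_
      · exact closure_mono (compl_subset_compl.2 (iInter_subset _ i))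
      · intro U hU hEU
        obtain ⟨y, hyK, hyU⟩ := (closure_inter_open_nonempty_iff hU).1 hEU
        obtain ⟨i, hi⟩ : ∃ i, y ∉ H i := by simpa [hK] using hyK
        filter_upwards [eventually_ge_atTop i] with j hj
        exact ⟨y, mem_insert_of_mem _ (subset_closure fun h => hi (hanti i j hj h)), hyU⟩
    refine ((hf.1.tendsto E).comp h1).congr fun i => ?_
    exact hadd i (s i) (hs i) (x i) (hxH i)
  have hEK : f E ∈ closure Kᶜ := hf.2 E
  have hqK : f E ∈ K := by
    have hne' := hne
    choose x hxH hxK using hne'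
    have h1 := key x (fun i => subset_closure (hxK i)) hxH
    rw [hKc]
    refine mem_iInter.2 fun i => mem_closure_of_tendsto h1 ?_
    filter_upwards [eventually_ge_atTop i] with j hj
    exact hanti i (s j) (hj.trans (hs j).le) (hxH j)
  refine ⟨f E, hqK, hKclosed, ?_, hEK, fun O hO hKO => ?_⟩
  · have : K \ {f E} = (closure Kᶜ)ᶜ := by
      refine Subset.antisymm (fun x hx hxK => hx.2 ?_) fun x hx => ⟨?_, fun h => hx (h ▸ hEK)⟩
      · exact tendsto_nhds_unique tendsto_const_nhds
          (key (fun _ => x) (fun _ => hxK) fun i => mem_iInter.1 hx.1 _)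
      · exact not_not.1 fun h => hx (subset_closure h)
    rw [this]
    exact isClosed_closure.isOpen_compl
  · by_contra! hcon
    choose x hxH hxO using fun i => not_subset.1 (hcon (s i))
    have h1 := key x (fun i => subset_closure fun h => hxO i (hKO h)) hxH
    obtain ⟨i, hi⟩ := (h1.eventually (hO.mem_nhds (hKO hqK))).exists
    exact hxO i hi

variable {q : X} {A B : Set X}

/-- Removing a small neighbourhood of `q` from `Bᶜ` and adding `Oᶜ` gives sets converging to `Bᶜ ∪
Oᶜ`, because `A` accumulates at `q`. The limit has value `q`, so the nearby values lie in `O`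
without being `q`; this leaves only `A`. -/
theorem IsMaximalSelectionAt.exists_apply_mem (hf : IsMaximalSelectionAt f q) (hB : IsOpen B)
    (hAB : Disjoint A B) (hq : A ∪ B = {q}ᶜ) (hqA : q ∈ closure A) {O : Set X} (hO : IsOpen O)
    (hqO : q ∈ O) (hOne : Oᶜ.Nonempty) :
    ∃ O' ⊆ O, IsOpen O' ∧ q ∈ O' ∧ ∃ T : Hyperspace X, Oᶜ ⊆ T.1 ∧ T.1 ⊆ O'ᶜ ∧ f T ∈ A := by
  have hqB : q ∉ B := fun h => (hq.subset (Or.inr h)) rfl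
  let T : Set X → Hyperspace X := fun W => ⟨(Bᶜ \ interior W) ∪ Oᶜ, hOne.mono subset_union_right,
    (hB.isClosed_compl.sdiff isOpen_interior).union hO.isClosed_compl⟩
  let E : Hyperspace X := ⟨Bᶜ ∪ Oᶜ, hOne.mono subset_union_right,
    hB.isClosed_compl.union hO.isClosed_compl⟩
  have hE : f E = q := hf.2 E (Or.inl hqB)
  have hT : Tendsto T (𝓝 q).smallSets (𝓝 E) := by
    refine tendsto_nhds_of_subset
      (Eventually.of_forall fun W => union_subset_union_left _ sdiff_subset) fun U hU hEU => ?_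
    obtain ⟨z, hz | hz, hzU⟩ := hEU
    · obtain ⟨a, haA, haU⟩ : ∃ a ∈ A, a ∈ U := by
        by_cases hzq : z = q
        · obtain ⟨a, haU, haA⟩ := mem_closure_iff.1 hqA U hU (hzq ▸ hzU)
          exact ⟨a, haA, haU⟩
        · exact ⟨z, ((hq.symm.subset hzq).resolve_right hz), hzU⟩
      have haq : q ≠ a := fun h => (hq.subset (Or.inl haA)) h.symm
      filter_upwards [eventually_smallSets_subset.2 (isOpen_compl_singleton.mem_nhds haq)]
        with W hW
      exact ⟨a, Or.inl ⟨disjoint_left.1 hAB haA, fun h => hW (interior_subset h) rfl⟩, haU⟩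
    · exact Eventually.of_forall fun W => ⟨z, Or.inr hz, hzU⟩
  have h1 : ∀ᶠ W in (𝓝 q).smallSets, f (T W) ∈ O :=
    ((hf.1.1.tendsto E).comp hT).eventually (hO.mem_nhds (by rwa [hE]))
  obtain ⟨W, hW, hWT⟩ := eventually_smallSets.1 h1
  have hfT := hWT W Subset.rfl
  have hqW : q ∈ interior W := mem_interior_iff_mem_nhds.2 hW
  refine ⟨O ∩ interior W, inter_subset_left, hO.inter isOpen_interior, ⟨hqO, hqW⟩, T W,
    subset_union_right, ?_, ?_⟩
  · rintro x (hx | hx) hxO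
    · exact hx.2 hxO.2
    · exact hx hxO.1
  · obtain ⟨hB', hW'⟩ := Or.resolve_right (hf.1.2 (T W)) fun h => h hfT
    exact (hq.symm.subset fun h : f (T W) = q => hW' (h ▸ hqW)).resolve_right hB'

/-- A cut point `q` with a `q`-maximal selection is the limit of a nontrivial sequence. -/
theorem IsMaximalSelectionAt.exists_seq_tendsto (hf : IsMaximalSelectionAt f q) (hA : IsOpen A)
    (hB : IsOpen B) (hAB : Disjoint A B) (hq : A ∪ B = {q}ᶜ) (hqA : q ∈ closure A)
    (hqB : q ∈ closure B) : ∃ a : ℕ → X, (∀ n, a n ≠ q) ∧ Tendsto a atTop (𝓝 q) := by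
  have step : ∀ O : {O : Set X // IsOpen O ∧ q ∈ O ∧ Oᶜ.Nonempty},
      ∃ O' : {O : Set X // IsOpen O ∧ q ∈ O ∧ Oᶜ.Nonempty}, O'.1 ⊆ O.1 ∧
      ∃ S T : Hyperspace X, O.1ᶜ ⊆ S.1 ∧ S.1 ⊆ O'.1ᶜ ∧ f S ∈ A ∧ O.1ᶜ ⊆ T.1 ∧ T.1 ⊆ O'.1ᶜ ∧
        f T ∈ B := by
    rintro ⟨O, hO, hqO, hne⟩
    obtain ⟨O₁, hO₁O, hO₁, hqO₁, S, hOS, hSO, hS⟩ := hf.exists_apply_mem hB hAB hq hqA hO hqO hne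
    obtain ⟨O₂, hO₂O, hO₂, hqO₂, T, hOT, hTO, hT⟩ :=
      hf.exists_apply_mem hA hAB.symm ((union_comm _ _).trans hq) hqB hO hqO hne
    exact ⟨⟨O₁ ∩ O₂, hO₁.inter hO₂, ⟨hqO₁, hqO₂⟩,
      hne.mono (compl_subset_compl.2 (inter_subset_left.trans hO₁O))⟩,
      inter_subset_left.trans hO₁O, S, T, hOS,
      hSO.trans (compl_subset_compl.2 inter_subset_left), hS, hOT,
      hTO.trans (compl_subset_compl.2 inter_subset_right), hT⟩
  choose nxt hnxt S T hOS hSO hSA hOT hTO hTB using step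
  obtain ⟨a₀, ha₀⟩ : A.Nonempty := closure_nonempty_iff.1 ⟨q, hqA⟩
  have ha₀q : q ≠ a₀ := fun h => (hq.subset (Or.inl ha₀)) h.symm
  let O : ℕ → {O : Set X // IsOpen O ∧ q ∈ O ∧ Oᶜ.Nonempty} := fun n =>
    nxt^[n] ⟨{a₀}ᶜ, isOpen_compl_singleton, ha₀q, ⟨a₀, by simp⟩⟩
  have hOsucc : ∀ n, O (n + 1) = nxt (O n) := fun n => Function.iterate_succ_apply' _ _ _
  have hOanti : Antitone fun n => (O n).1 := antitone_nat_of_succ_le fun n => by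
    simp only [hOsucc]
    exact hnxt _
  let E : Hyperspace X := ⟨closure (⋃ n, (O n).1ᶜ), by
    obtain ⟨x, hx⟩ := (O 0).2.2.2
    exact ⟨x, subset_closure (mem_iUnion.2 ⟨0, hx⟩)⟩, isClosed_closure⟩
  have hlim : ∀ R : ℕ → Hyperspace X, (∀ n, (O n).1ᶜ ⊆ (R n).1) →
      (∀ n, (R n).1 ⊆ (O (n + 1)).1ᶜ) → Tendsto (fun n => f (R n)) atTop (𝓝 (f E)) := by
    intro R hR hR'
    refine (hf.1.1.tendsto E).comp (tendsto_nhds_of_subset (Eventually.of_forall fun n =>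
      (hR' n).trans ((subset_iUnion (fun n => (O n).1ᶜ) (n + 1)).trans subset_closure)) ?_)
    intro U hU hEU
    obtain ⟨x, hx, hxU⟩ := (closure_inter_open_nonempty_iff hU).1 hEU
    obtain ⟨m, hm⟩ := mem_iUnion.1 hx
    filter_upwards [eventually_ge_atTop m] with n hn
    exact ⟨x, hR n (compl_subset_compl.2 (hOanti hn) hm), hxU⟩
  have hSlim := hlim (fun n => S (O n)) (fun n => hOS _) fun n => by
    rw [hOsucc]; exact hSO _
  have hTlim := hlim (fun n => T (O n)) (fun n => hOT _) fun n => by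
    rw [hOsucc]; exact hTO _
  -- `f E` is a limit of points of `A` and also of points of `B`. These are disjoint open sets
  -- covering everything but `q`.
  have hEq : f E = q := by
    by_contra hne
    rcases hq.symm.subset hne with h | h
    · obtain ⟨n, hn⟩ := (hTlim.eventually (hA.mem_nhds h)).exists
      exact disjoint_left.1 hAB hn (hTB _)
    · obtain ⟨n, hn⟩ := (hSlim.eventually (hB.mem_nhds h)).exists
      exact disjoint_left.1 hAB (hSA _) hn
  rw [hEq] at hSlim
  exact ⟨_, fun n => hq.subset (Or.inl (hSA _)), hSlim⟩

/-- A cut point `q` with a `q`-maximal selection is the intersection of countably many of its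
neighbourhoods. -/
theorem IsMaximalSelectionAt.exists_iInter_eq_singleton (hf : IsMaximalSelectionAt f q)
    (hA : IsOpen A) (hB : IsOpen B) (hAB : Disjoint A B) (hq : A ∪ B = {q}ᶜ)
    (hqA : q ∈ closure A) (hqB : q ∈ closure B) :
    ∃ U : ℕ → Set X, (∀ n, U n ∈ 𝓝 q) ∧ ⋂ n, U n = {q} := by
  obtain ⟨a, haq, ha⟩ := hf.exists_seq_tendsto hA hB hAB hq hqA hqB
  -- A point `x ≠ q` escapes one of these neighbourhoods: `f {x, a n}` tends to `f {x, q} = q`, so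
  -- some `a n` is picked over `x`.
  have hU : ∀ n, {x | f (addPoint {a n} isClosed_singleton x) ≠ a n} ∈ 𝓝 q := fun n =>
    (hf.1.continuous_addPoint _ _).continuousAt.eventually_ne (by
      rw [hf.apply_pair]; exact (haq n).symm)
  refine ⟨_, hU, Subset.antisymm (fun x hx => ?_)
    (singleton_subset_iff.2 (mem_iInter.2 fun n => mem_of_mem_nhds (hU n)))⟩
  by_contra hxq
  have h1 : Tendsto (fun n => f (addPoint {x} isClosed_singleton (a n))) atTop (𝓝 q) := by
    have := ((hf.1.continuous_addPoint {x} isClosed_singleton).tendsto q).comp ha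
    rwa [hf.apply_pair] at this
  obtain ⟨n, hn⟩ := (h1.eventually (isOpen_compl_singleton.mem_nhds (Ne.symm hxq))).exists
  refine mem_iInter.1 hx n ?_
  rw [apply_addPoint_comm f]
  exact (hf.1.addPoint_eq_or _ _ _).resolve_right hn

end Limits

/-! ### Transfinite shrinking of clopen neighbourhoods -/

section Recursion

universe u

open Order
open scoped Cardinal

theorem exists_ordinal_family {X : Type u} {l : Filter X} {U : ℕ → Set X} (hU : ∀ n, U n ∈ l) :
    ∃ U' : Ordinal.{u} → Set X, (∀ α, U' α ∈ l) ∧ ∀ n : ℕ, U' n = U n := by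
  have hinj : Function.Injective (Nat.cast : ℕ → Ordinal.{u}) := Nat.cast_injective
  refine ⟨Function.extend Nat.cast U fun _ => univ, fun α => ?_, hinj.extend_apply _ _⟩
  by_cases h : ∃ n : ℕ, (n : Ordinal.{u}) = α
  · obtain ⟨n, rfl⟩ := h
    rw [hinj.extend_apply]
    exact hU n
  · rw [Function.extend_apply' _ _ _ h]
    exact univ_mem

variable {X : Type u} [TopologicalSpace X] [T2Space X] {f : Hyperspace X → X} {p : X}

/-- One step of the recursion. Adding `p` to `closure Sᶜ` gives the value `p`, interior to `S`; by
continuity the value stays off `closure Sᶜ` for `x` near `p`, so it must be `x`. Strictness comes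
from avoiding a second point of the interior. -/
theorem IsMaximalSelectionAt.exists_isClopen_ssubset (hf : IsMaximalSelectionAt f p)
    (hz : ∀ U ∈ 𝓝 p, ∃ C, IsClopen C ∧ p ∈ C ∧ C ⊆ U) (hp : ¬ IsOpen {p}) {S U : Set X}
    (hS : S ∈ 𝓝 p) (hU : U ∈ 𝓝 p) :
    ∃ C, IsClopen C ∧ p ∈ C ∧ C ⊂ S ∧ C ⊆ U ∧
      ∀ x ∈ C, f (addPoint (closure Sᶜ) isClosed_closure x) = x := by
  obtain ⟨y, hyS, hyp⟩ : ∃ y ∈ interior S, y ≠ p := by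
    by_contra! h
    refine hp ?_
    rw [show {p} = interior S from
      Subset.antisymm (singleton_subset_iff.2 (mem_interior_iff_mem_nhds.2 hS)) h]
    exact isOpen_interior
  have hW : {x | f (addPoint (closure Sᶜ) isClosed_closure x) ∈ interior S} ∈ 𝓝 p := by
    refine (isOpen_interior.preimage (hf.1.continuous_addPoint _ _)).mem_nhds ?_
    change f _ ∈ interior S
    rw [hf.2 _ (mem_insert _ _)]
    exact mem_interior_iff_mem_nhds.2 hS
  obtain ⟨C, hC, hpC, hCW⟩ := hz _ (inter_mem (inter_mem (interior_mem_nhds.2 hS) hU)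
    (inter_mem hW (isOpen_compl_singleton.mem_nhds hyp.symm)))
  refine ⟨C, hC, hpC, ⟨fun x hx => interior_subset (hCW hx).1.1, fun h => ?_⟩,
    fun x hx => (hCW hx).1.2, fun x hx => ?_⟩
  · exact (hCW (h (interior_subset hyS))).2.2 rfl
  · refine (hf.1.addPoint_eq_or _ _ x).resolve_right fun h => ?_
    exact closure_compl.subset h (hCW hx).2.1

/-- The transfinite construction of decreasing neighbourhoods of `p`. -/
theorem IsMaximalSelectionAt.exists_decreasing (hf : IsMaximalSelectionAt f p)
    (hz : ∀ U ∈ 𝓝 p, ∃ C, IsClopen C ∧ p ∈ C ∧ C ⊆ U) (hp : ¬ IsOpen {p}) {c : Cardinal.{u}}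
    (hc : ∀ s : Set (Set X), #↥s < c → (∀ V ∈ s, V ∈ 𝓝 p) → ⋂₀ s ∈ 𝓝 p)
    {U : Ordinal.{u} → Set X} (hU : ∀ α, U α ∈ 𝓝 p) :
    ∃ H : Ordinal.{u} → Set X, Antitone H ∧ H 0 = univ ∧ (∀ α < c.ord, H α ∈ 𝓝 p) ∧
      (∀ α ≤ c.ord, p ∈ H α) ∧
      (∀ α < c.ord, IsClopen (H (succ α)) ∧ H (succ α) ⊆ U α ∧ H (succ α) ⊂ H α) ∧
      ∀ l ≤ c.ord, IsSuccLimit l → ∃ q ∈ H l, IsClosed (H l) ∧ IsOpen (H l \ {q}) ∧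
        q ∈ closure (H l)ᶜ ∧ ∀ O, IsOpen O → H l ⊆ O → ∃ α < l, H α ⊆ O := by
  choose! N hN using fun (α : Ordinal.{u}) (S : Set X) (hS : S ∈ 𝓝 p) =>
    hf.exists_isClopen_ssubset hz hp hS (hU α)
  -- Intersecting the successors of all earlier stages treats zero, successors and limits uniformly.
  obtain ⟨H, hH⟩ : ∃ H : Ordinal.{u} → Set X, ∀ α, H α = ⋂ β, ⋂ _ : β < α, N β (H β) :=
    ⟨WellFoundedLT.fix (motive := fun _ => Set X) fun α ih => ⋂ β, ⋂ h : β < α, N β (ih β h),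
      fun α => WellFoundedLT.fix_eq _ α⟩
  have hanti : Antitone H := fun α β hαβ => by
    rw [hH α, hH β]
    exact iInter_mono fun γ => iInter_mono' fun h => ⟨h.trans_le hαβ, Subset.rfl⟩
  have hnhds : ∀ α < c.ord, H α ∈ 𝓝 p := fun α => by
    induction α using WellFoundedLT.induction with
    | ind α ih =>
      intro hα
      have h1 : H α = ⋂₀ ((fun β => N β (H β)) '' Iio α) := by
        rw [hH α, sInter_image]; rfl
      rw [h1]
      refine hc _ ?_ ?_
      · have := Cardinal.mk_image_le_lift (f := fun β => N β (H β)) (s := Iio α)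
        rw [Cardinal.mk_Iio_ordinal, Cardinal.lift_lift, ← Cardinal.lift_umax,
          Cardinal.lift_le] at this
        exact this.trans_lt (Cardinal.lt_ord.1 hα)
      · rintro _ ⟨β, hβ, rfl⟩
        have := hN β (H β) (ih β hβ (lt_trans hβ hα))
        exact this.1.2.mem_nhds this.2.1
  have hsucc : ∀ α < c.ord, H (succ α) = N α (H α) := fun α hα => by
    refine Subset.antisymm ?_ ?_
    · rw [hH (succ α)]
      exact iInter₂_subset α (lt_succ α)
    · rw [hH (succ α)]
      refine subset_iInter₂ fun β hβ => ?_
      rcases (lt_succ_iff.1 hβ).eq_or_lt with rfl | hβ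
      · exact Subset.rfl
      · refine (hN α (H α) (hnhds α hα)).2.2.1.subset.trans ?_
        rw [hH α]
        exact iInter₂_subset β hβ
  have hNH : ∀ α < c.ord, _ := fun α hα => hN α (H α) (hnhds α hα)
  have hstep : ∀ α < c.ord, IsClopen (H (succ α)) ∧ H (succ α) ⊆ U α ∧ H (succ α) ⊂ H α :=
    fun α hα => by
      obtain ⟨h1, h2, h3, h4, h5⟩ := hNH α hα
      rw [hsucc α hα]
      exact ⟨h1, h4, h3⟩
  refine ⟨H, hanti, ?_, hnhds, fun α hα => ?_, hstep, fun l hl hlim => ?_⟩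
  · rw [hH 0]
    simp
  · rw [hH α]
    exact mem_iInter₂.2 fun β hβ => (hNH β (hβ.trans_le hα)).2.1
  · have hHl : H l = ⋂ i : Iio l, H i := by
      refine Subset.antisymm (subset_iInter fun i => hanti i.2.le) ?_
      rw [hH l]
      refine subset_iInter₂ fun β hβ => ?_
      rw [← hsucc β (hβ.trans_le hl)]
      exact iInter_subset (fun i : Iio l => H i) ⟨succ β, hlim.succ_lt hβ⟩
    have : Nonempty (Iio l) := ⟨⟨0, hlim.bot_lt⟩⟩
    have : NoMaxOrder (Iio l) := ⟨fun a => ⟨⟨succ a, hlim.succ_lt a.2⟩, lt_succ a.1⟩⟩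
    have hi : ∀ i : Iio l, _ := fun i => hstep i (lt_of_lt_of_le i.2 hl)
    have hij' : ∀ i j : Iio l, i < j → H j ⊆ H (succ i) := fun i j hij =>
      hanti (succ_le_of_lt hij)
    obtain ⟨q, h1, h2, h3, h4, h5⟩ := hf.1.exists_boundary_point (H := fun i : Iio l => H i)
      (fun i j hij => (hij' i j hij).trans_ssubset (hi i).2.2)
      (fun i j hij => (closure_minimal (hij' i j hij) (hi i).1.1).trans
        ((hi i).1.2.subset_interior_iff.2 (hi i).2.2.subset))
      (fun i j hij x hx => (hNH i (lt_of_lt_of_le i.2 hl)).2.2.2.2 x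
        (hsucc i (lt_of_lt_of_le i.2 hl) ▸ hij' i j hij hx))
    rw [hHl]
    refine ⟨q, h1, h2, h3, h4, fun O hO hHO => ?_⟩
    obtain ⟨i, hi⟩ := h5 O hO hHO
    exact ⟨i, i.2, hi⟩

/-- Running the recursion through `ω` inside the sets `U n` makes the intersection at stage `ω`
equal to `{p}`, and the limit clause turns the finite stages into a base at `p`. -/
theorem IsMaximalSelectionAt.isCountablyGenerated_nhds (hf : IsMaximalSelectionAt f p)
    (hz : ∀ U ∈ 𝓝 p, ∃ C, IsClopen C ∧ p ∈ C ∧ C ⊆ U) {U : ℕ → Set X} (hU : ∀ n, U n ∈ 𝓝 p)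
    (hUp : ⋂ n, U n = {p}) : (𝓝 p).IsCountablyGenerated := by
  by_cases hp : IsOpen {p}
  · rw [(isOpen_singleton_iff_nhds_eq_pure p).1 hp]
    infer_instance
  obtain ⟨U', hU', hUU'⟩ := exists_ordinal_family hU
  obtain ⟨H, hanti, -, hnhds, -, hstep, hlim⟩ := hf.exists_decreasing hz hp (c := ℵ₀)
    (fun s hs h => (sInter_mem (Cardinal.lt_aleph0_iff_set_finite.1 hs)).2 h) hU'
  rw [Cardinal.ord_aleph0] at *
  obtain ⟨q, hq, -, -, -, hbase⟩ := hlim _ le_rfl Ordinal.isSuccLimit_omega0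
  have hHp : H Ordinal.omega0 ⊆ {p} := by
    rw [← hUp]
    refine subset_iInter fun n => ?_
    have h1 := (hstep n (Ordinal.natCast_lt_omega0 n)).2.1
    rw [hUU'] at h1
    exact (hanti (succ_le_of_lt (Ordinal.natCast_lt_omega0 n))).trans h1
  have : (𝓝 p).HasBasis (fun _ : ℕ => True) fun n => H n := by
    refine ⟨fun t => ⟨fun ht => ?_, fun ⟨n, _, hn⟩ =>
      mem_of_superset (hnhds n (Ordinal.natCast_lt_omega0 n)) hn⟩⟩
    obtain ⟨α, hα, hαt⟩ := hbase (interior t) isOpen_interior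
      (hHp.trans (singleton_subset_iff.2 (mem_interior_iff_mem_nhds.2 ht)))
    obtain ⟨n, rfl⟩ := Ordinal.lt_omega0.1 hα
    exact ⟨n, trivial, hαt.trans interior_subset⟩
  exact this.isCountablyGenerated

end Recursion

/-! ### From maximal selections to well-ordered bases -/

section WellOrderable

universe u

open Order
open scoped Cardinal

variable {X : Type u}

/-- A filter which is not principal is closed under intersections of fewer than `c` members but not
under those of `c` members, for some regular cardinal `c`. -/
theorem exists_isRegular_sInter_notMem {l : Filter X}
    (hl : ∃ s : Set (Set X), (∀ V ∈ s, V ∈ l) ∧ ⋂₀ s ∉ l) :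
    ∃ c : Cardinal.{u}, c.IsRegular ∧
      (∀ s : Set (Set X), #↥s < c → (∀ V ∈ s, V ∈ l) → ⋂₀ s ∈ l) ∧
      ∃ U : Ordinal.{u} → Set X, (∀ α, U α ∈ l) ∧ (⋂ α, ⋂ _ : α < c.ord, U α) ∉ l := by
  let C : Set Cardinal.{u} := {c | ∃ s : Set (Set X), ((∀ V ∈ s, V ∈ l) ∧ ⋂₀ s ∉ l) ∧ #↥s = c}
  have hCne : C.Nonempty := hl.elim fun s hs => ⟨_, s, hs, rfl⟩
  obtain ⟨s, ⟨hs, hsl⟩, hsc⟩ := csInf_mem hCne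
  set c := sInf C with hc
  have hlt : ∀ s : Set (Set X), #↥s < c → (∀ V ∈ s, V ∈ l) → ⋂₀ s ∈ l := fun t ht htl => by
    by_contra h
    exact notMem_of_lt_csInf' ht ⟨t, ⟨htl, h⟩, rfl⟩
  obtain ⟨e⟩ : Nonempty (c.ord.ToType ≃ s) := Cardinal.eq.1 (by simp [hsc])
  have hinter : ∀ T : Set X, (∀ i, T ⊆ (e i).1) → T ∉ l := fun T hT h => by
    refine hsl (mem_of_superset h (subset_sInter fun V hV => ?_))
    have := hT (e.symm ⟨V, hV⟩)
    rwa [e.apply_symm_apply] at this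
  refine ⟨c, ⟨?_, ?_⟩, hlt, ?_⟩
  · by_contra! h
    exact hsl ((sInter_mem (Cardinal.lt_aleph0_iff_set_finite.1 (hsc.trans_lt h))).2 hs)
  · by_contra! h
    obtain ⟨S, hS, hScard⟩ := Order.exists_cof_eq c.ord.ToType
    rw [Ordinal.cof_toType] at hScard
    -- Each initial segment involves fewer than `c` members, so its intersection is in `l` by
    -- minimality of `c`. Fewer than `c` cofinal segments would then put the whole intersection in
    -- `l`.
    let V : c.ord.ToType → Set X := fun t => ⋂₀ ((fun i => (e i).1) '' Iio t) ∩ (e t).1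
    have hV : ∀ t, V t ∈ l := fun t => by
      refine inter_mem (hlt _ (Cardinal.mk_image_le.trans_lt ((Cardinal.mk_Iio_lt t (by simp)).trans_eq
        (by simp))) ?_)
        (hs _ (e t).2)
      rintro _ ⟨i, -, rfl⟩
      exact hs _ (e i).2
    refine hinter (⋂₀ (V '' S)) (fun i => ?_)
      (hlt _ (Cardinal.mk_image_le.trans_lt (hScard.trans_lt h)) ?_)
    · obtain ⟨t, htS, hit⟩ := hS i
      refine (sInter_subset_of_mem (mem_image_of_mem V htS)).trans ?_
      rcases hit.eq_or_lt with rfl | hit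
      · exact inter_subset_right
      · exact inter_subset_left.trans (sInter_subset_of_mem ⟨i, hit, rfl⟩)
    · rintro _ ⟨t, -, rfl⟩
      exact hV t
  · classical
    refine ⟨fun α => if h : α < c.ord then (e (Ordinal.ToType.mk ⟨α, h⟩)).1 else univ, fun α => ?_,
      hinter _ fun i => ?_⟩
    · dsimp only
      split_ifs with h
      · exact hs _ (e _).2
      · exact univ_mem
    · obtain ⟨⟨α, hα⟩, rfl⟩ := Ordinal.ToType.mk.surjective i
      intro x hx
      have h := mem_iInter₂.1 hx α hα
      dsimp only at h
      rwa [dif_pos (mem_Iio.1 hα)] at h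

variable [TopologicalSpace X]

theorem mem_deltaOmega_of_isClopen {H : Set X} (hH : IsClopen H) {p : X} (hp : p ∈ H)
    [T1Space X] : H ∈ DeltaOmega X :=
  ⟨⟨p, hH.1, hp, hH.2.sdiff isClosed_singleton⟩, Or.inl hH⟩

variable [T2Space X]

/-- Either `q` is isolated in `H`, or it is a cut point between `H \ {q}` and `Hᶜ`; in the latter
case it has a countable base even in `X`. -/
theorem SelectionPointwiseMaximal.mem_deltaOmega (hX : SelectionPointwiseMaximal X) {H : Set X}
    {q : X} (hq : q ∈ H) (hH : IsClosed H) (hHq : IsOpen (H \ {q})) (hqH : q ∈ closure Hᶜ) :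
    H ∈ DeltaOmega X := by
  refine ⟨⟨q, hH, hq, hHq⟩, Or.inr ⟨q, hq, ⟨hH, hq, hHq⟩, ?_⟩⟩
  by_cases h : q ∈ closure (H \ {q})
  · obtain ⟨f, hf⟩ : ∃ f, IsMaximalSelectionAt f q := hX q
    obtain ⟨U, hU, hUq⟩ := hf.exists_iInter_eq_singleton hHq hH.isOpen_compl
      (disjoint_compl_right.mono_left sdiff_subset) (by
        ext x
        by_cases hx : x ∈ H
        · simp [hx]
        · simpa [hx] using fun h : x = q => hx (h ▸ hq)) h hqH
    have := hf.isCountablyGenerated_nhds (fun U hU => hX.exists_isClopen hU) hU hUq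
    rw [nhds_subtype_eq_comap]
    infer_instance
  · have h1 : ({⟨q, hq⟩} : Set H) = Subtype.val ⁻¹' (closure (H \ {q}))ᶜ := by
      refine Subset.antisymm (singleton_subset_iff.2 h) fun x hx => ?_
      by_contra hxq
      exact hx (subset_closure ⟨x.2, fun h => hxq (Subtype.ext h)⟩)
    rw [(isOpen_singleton_iff_nhds_eq_pure _).1
      (h1 ▸ isClosed_closure.isOpen_compl.preimage continuous_subtype_val)]
    infer_instance

/-- Selection pointwise-maximal spaces are pointwise well-orderable. -/
theorem SelectionPointwiseMaximal.pointwiseWellOrderable (hX : SelectionPointwiseMaximal X) :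
    PointwiseWellOrderable X := fun p => by
  by_cases hp : IsOpen {p}
  · have hlt : ∀ α : Ordinal.{u}, α < Cardinal.ord 1 ↔ α = 0 := by simp
    refine ⟨1, fun _ => {p}, Or.inl rfl, fun α _ => mem_deltaOmega_of_isClopen
      ⟨isClosed_singleton, hp⟩ rfl, ⟨fun t => ?_⟩, fun α hα => ?_, fun α hα => ?_,
      fun l hl hlim => ?_⟩
    · rw [(isOpen_singleton_iff_nhds_eq_pure p).1 hp, mem_pure]
      exact ⟨fun h => ⟨0, (hlt 0).2 rfl, singleton_subset_iff.2 h⟩, fun ⟨_, _, h⟩ => h rfl⟩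
    · exact absurd ((hlt _).1 hα) (succ_ne_bot α)
    · exact absurd ((hlt _).1 hα) (succ_ne_bot α)
    · exact absurd ((hlt _).1 hl) hlim.bot_lt.ne'
  have hz : ∀ U ∈ 𝓝 p, ∃ C, IsClopen C ∧ p ∈ C ∧ C ⊆ U := fun U hU => hX.exists_isClopen hU
  obtain ⟨f, hf⟩ : ∃ f, IsMaximalSelectionAt f p := hX p
  have hnp : ⋂₀ {V | V ∈ 𝓝 p} ∉ 𝓝 p := fun h => by
    refine hp ((isOpen_singleton_iff_nhds_eq_pure p).2
      (le_antisymm (le_pure_iff.2 (mem_of_superset h fun x hx => ?_)) (pure_le_nhds p)))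
    by_contra hxp
    exact hx {x}ᶜ (isOpen_compl_singleton.mem_nhds (Ne.symm hxp)) rfl
  obtain ⟨c, hreg, hc, U, hU, hUp⟩ := exists_isRegular_sInter_notMem ⟨_, fun _ => id, hnp⟩
  have hclim : IsSuccLimit c.ord := Cardinal.isSuccLimit_ord hreg.aleph0_le
  -- The recursion is run twice. The first run, inside `U`, need not shrink to `{p}`, but its final
  -- intersection has `p` as boundary point. This yields neighbourhoods `U'` that do intersect in
  -- `{p}`, and the second run uses them.
  obtain ⟨U', hU', hU'p⟩ : ∃ U' : Ordinal.{u} → Set X, (∀ α, U' α ∈ 𝓝 p) ∧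
      (⋂ α, ⋂ _ : α < c.ord, U' α) ⊆ {p} := by
    obtain ⟨H, hanti, -, hnhds, hpH, hstep, hlim⟩ := hf.exists_decreasing hz hp hc hU
    obtain ⟨q, hq, hK, hKq, hqK, hbase⟩ := hlim _ le_rfl hclim
    -- Otherwise `H c.ord \ {q}` would be a neighbourhood of `p` inside the intersection of the `U
    -- α`.
    obtain rfl : q = p := by
      by_contra hqp
      refine hUp (mem_of_superset (hKq.mem_nhds ⟨hpH _ le_rfl, Ne.symm hqp⟩)
        (subset_iInter₂ fun α hα => ?_))
      exact (sdiff_subset.trans (hanti (succ_le_of_lt hα))).trans (hstep α hα).2.1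
    by_cases h : q ∈ closure (H c.ord \ {q})
    · obtain ⟨V, hV, hVq⟩ := hf.exists_iInter_eq_singleton hKq hK.isOpen_compl
        (disjoint_compl_right.mono_left sdiff_subset) (by
          ext x
          by_cases hx : x ∈ H c.ord
          · simp [hx]
          · simpa [hx] using fun h : x = q => hx (h ▸ hq)) h hqK
      obtain ⟨U', hU', hUV⟩ := exists_ordinal_family hV
      refine ⟨U', hU', ?_⟩
      rw [← hVq]
      refine subset_iInter fun n => ?_
      rw [← hUV n]
      have hn : (n : Ordinal.{u}) < c.ord := (Ordinal.natCast_lt_omega0 n).trans_le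
        (Cardinal.ord_aleph0.symm.trans_le (Cardinal.ord_le_ord.2 hreg.aleph0_le))
      exact fun x hx => mem_iInter₂.1 hx _ hn
    · classical
      -- Here the rest of `H c.ord` stays away from `q`, so it can be deleted from every stage.
      refine ⟨fun α => if α < c.ord then H α ∩ (H c.ord \ {q})ᶜ else univ, fun α => ?_,
        fun x hx => ?_⟩
      · dsimp only
        split_ifs with hα
        · refine inter_mem (hnhds α hα) (mem_of_superset
            (isClosed_closure.isOpen_compl.mem_nhds h) (compl_subset_compl.2 subset_closure))
        · exact univ_mem
      · have hx' : ∀ α < c.ord, x ∈ H α ∩ (H c.ord \ {q})ᶜ := fun α hα => by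
          simpa [hα] using mem_iInter₂.1 hx α hα
        have hxK : x ∈ H c.ord := by
          by_contra hxK
          obtain ⟨α, hα, hαx⟩ := hbase {x}ᶜ isOpen_compl_singleton
            fun y hy hyx => hxK (hyx ▸ hy)
          exact hαx (hx' α hα).1 rfl
        by_contra hxq
        exact (hx' 0 hclim.bot_lt).2 ⟨hxK, hxq⟩
  obtain ⟨H, hanti, h0, hnhds, hpH, hstep, hlim⟩ := hf.exists_decreasing hz hp hc hU'
  have hHc : H c.ord ⊆ {p} := (subset_iInter₂ fun α hα =>
    (hanti (succ_le_of_lt hα)).trans (hstep α hα).2.1).trans hU'p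
  refine ⟨c, H, Or.inr hreg, fun α hα => ?_, ⟨fun t => ?_⟩, fun α hα => ?_, fun α hα => ?_,
    fun l hl hll => ⟨fun t => ?_⟩⟩
  · rcases Ordinal.zero_or_succ_or_isSuccLimit α with rfl | ⟨β, rfl⟩ | hαl
    · rw [h0]
      exact mem_deltaOmega_of_isClopen isClopen_univ (mem_univ p)
    · exact mem_deltaOmega_of_isClopen (hstep β ((lt_succ β).trans hα)).1 (hpH _ hα.le)
    · obtain ⟨q, hq, hK, hKq, hqK, -⟩ := hlim α hα.le hαl
      exact hX.mem_deltaOmega hq hK hKq hqK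
  · refine ⟨fun ht => ?_, fun ⟨α, hα, hαt⟩ => mem_of_superset (hnhds α hα) hαt⟩
    obtain ⟨-, -, -, -, -, hbase⟩ := hlim _ le_rfl hclim
    obtain ⟨α, hα, hαt⟩ := hbase (interior t) isOpen_interior
      (hHc.trans (singleton_subset_iff.2 (mem_interior_iff_mem_nhds.2 ht)))
    exact ⟨α, hα, hαt.trans interior_subset⟩
  · exact (hstep α ((lt_succ α).trans hα)).1
  · exact (hstep α ((lt_succ α).trans hα)).2.2
  · obtain ⟨-, -, -, -, -, hbase⟩ := hlim _ hl.le hll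
    refine ⟨fun ht => ?_, fun ⟨α, hα, hαt⟩ => ?_⟩
    · obtain ⟨α, hα, hαt⟩ := hbase (interior t) isOpen_interior (subset_interior_iff_mem_nhdsSet.2 ht)
      exact ⟨α, hα, hαt.trans interior_subset⟩
    · have hs := hstep α (hα.trans hl)
      exact mem_of_superset (hs.1.2.mem_nhdsSet.2 (hanti (succ_le_of_lt hα)))
        (hs.2.2.subset.trans hαt)

end WellOrderable

/-! ### From well-ordered bases to ordinal decompositions -/

section Decomposition

universe u

open Order

variable {X : Type u} [TopologicalSpace X]

theorem isCountablyGenerated_nhds_subtype_iff {H : Set X} {q : X} (hq : q ∈ H) :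
    (𝓝 (⟨q, hq⟩ : H)).IsCountablyGenerated ↔ (𝓝[H] q).IsCountablyGenerated := by
  refine ⟨fun h => ?_, fun h => ?_⟩
  · rw [nhdsWithin_eq_map_subtype_coe hq]; infer_instance
  · rw [nhds_subtype_eq_comap_nhdsWithin]; infer_instance

theorem sdiff_mem_deltaOmega [T1Space X] {H C : Set X} (hH : H ∈ DeltaOmega X) (hC : IsClopen C)
    (hne : (H \ C).Nonempty) : H \ C ∈ DeltaOmega X := by
  obtain ⟨x, hx⟩ := hne
  obtain ⟨-, h | ⟨q, hq, ⟨hHc, -, hHq⟩, hcg⟩⟩ := hH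
  · exact mem_deltaOmega_of_isClopen (h.diff hC) hx
  have hcl : IsClosed (H \ C) := hHc.sdiff hC.2
  by_cases hqC : q ∈ C
  · refine mem_deltaOmega_of_isClopen ⟨hcl, ?_⟩ hx
    have : H \ C = (H \ {q}) \ C := by
      ext y
      exact ⟨fun h => ⟨⟨h.1, fun hy => h.2 (hy ▸ hqC)⟩, h.2⟩, fun h => ⟨h.1.1, h.2⟩⟩
    rw [this]
    exact hHq.sdiff hC.1
  · have hmod : IsClopenModuloAt (H \ C) q := by
      refine ⟨hcl, ⟨hq, hqC⟩, ?_⟩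
      rw [sdiff_sdiff_comm]
      exact hHq.sdiff hC.1
    refine ⟨⟨q, hmod⟩, Or.inr ⟨q, ⟨hq, hqC⟩, hmod, ?_⟩⟩
    rw [isCountablyGenerated_nhds_subtype_iff] at hcg
    refine (isCountablyGenerated_nhds_subtype_iff (H := H \ C) (q := q) ⟨hq, hqC⟩).2 ?_
    rwa [sdiff_eq, nhdsWithin_inter_of_mem' (mem_nhdsWithin_of_mem_nhds
      (hC.1.isOpen_compl.mem_nhds hqC))]

/-- The fibres of a closed continuous map onto `[0, γ]` form an ordinal decomposition. -/
theorem isOrdinalDecomposition_range_fiber {γ : Ordinal.{u}} {π : X → Iic γ} (hc : Continuous π)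
    (hcl : IsClosedMap π) (hs : Function.Surjective π) (hΔ : ∀ y, π ⁻¹' {y} ∈ Delta X) :
    IsOrdinalDecomposition (range fun y => π ⁻¹' {y}) := by
  have hclasses : (range fun y => π ⁻¹' {y}) = (Setoid.ker π).classes := by
    ext A
    constructor
    · rintro ⟨y, rfl⟩
      obtain ⟨x, rfl⟩ := hs y
      exact ⟨x, rfl⟩
    · rintro ⟨x, rfl⟩
      exact ⟨π x, rfl⟩
  refine ⟨?_, ⟨?_, ?_⟩, ?_⟩
  · rintro _ ⟨y, rfl⟩
    exact hΔ y
  · rw [hclasses]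
    exact Setoid.isPartition_classes _
  · rintro _ ⟨y, rfl⟩ U hU hyU
    refine ⟨π ⁻¹' (π '' Uᶜ)ᶜ, (hcl _ hU.isClosed_compl).isOpen_compl.preimage hc, ?_, ?_,
      (fun y => π ⁻¹' {y}) '' (π '' Uᶜ)ᶜ, image_subset_range _ _, ?_⟩
    · rintro x hx ⟨z, hz, hzx⟩
      exact hz (hyU (hzx.trans hx))
    · exact fun x hx => not_not.1 fun h => hx ⟨x, h, rfl⟩
    · rw [sUnion_image, ← biUnion_preimage_singleton]
  · rw [hclasses]
    refine ⟨Setoid.isPartition_classes _, γ, ?_⟩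
    have h := Setoid.mkClasses_classes (Setoid.ker π)
    have e : Nonempty (Quotient (Setoid.ker π) ≃ₜ Iic γ) :=
      ⟨IsQuotientMap.homeomorph (f := ⟨π, hc⟩) (hcl.isQuotientMap hc hs)⟩
    unfold DecompositionSpace
    rwa [h]

theorem isClosedMap_of_forall_fiber {Y : Type*} [TopologicalSpace Y] {π : X → Y}
    (h : ∀ y, ∀ U, IsOpen U → π ⁻¹' {y} ⊆ U → ∃ N ∈ 𝓝 y, π ⁻¹' N ⊆ U) : IsClosedMap π := by
  refine fun S hS => isOpen_compl_iff.1 (isOpen_iff_mem_nhds.2 fun y hy => ?_)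
  obtain ⟨N, hN, hNS⟩ := h y Sᶜ hS.isOpen_compl fun x hx hxS => hy ⟨x, hxS, hx⟩
  refine mem_of_superset hN ?_
  rintro _ hz ⟨x, hxS, rfl⟩
  exact hNS hz hxS

/-- A decreasing ordinal family of clopen sets, which is a base at `p` and at its intersection over
each limit ordinal, gives rise to an ordinal decomposition. -/
theorem exists_isOrdinalDecomposition_of_decreasing [T1Space X] {γ : Ordinal.{u}}
    {B : Ordinal.{u} → Set X} {p : X} (hB : ∀ β < γ, IsClopen (B β))
    (hanti : ∀ β < γ, ∀ α ≤ β, B β ⊆ B α) (hp : ∀ U ∈ 𝓝 p, U = univ ∨ ∃ β < γ, B β ⊆ U)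
    (hpB : ∀ β < γ, p ∈ B β) (hne : ∀ α < γ, ((⋂ β, ⋂ _ : β < α, B β) \ B α).Nonempty)
    (hΔ : ∀ α < γ, (⋂ β, ⋂ _ : β < α, B β) \ B α ∈ DeltaOmega X)
    (hlim : ∀ l < γ, IsSuccLimit l → ∀ U, IsOpen U → (⋂ β, ⋂ _ : β < l, B β) ⊆ U →
      ∃ β < l, B β ⊆ U) :
    ∃ 𝓓 : Set (Set X), IsOrdinalDecomposition 𝓓 ∧ 𝓓 ⊆ DeltaOmega X ∧ {p} ∈ 𝓓 := by
  -- The stage at which `x` leaves the family. The value `γ` qualifies vacuously and is taken only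
  -- at `p`, which never leaves.
  let r : X → Ordinal.{u} := fun x => sInf {β | β < γ → x ∉ B β}
  have hr : ∀ x, r x ≤ γ := fun x => csInf_le' fun h => absurd h (lt_irrefl γ)
  have hle : ∀ α < γ, ∀ x, r x ≤ α ↔ x ∉ B α := fun α hα x => by
    refine ⟨fun h hx => ?_, fun h => csInf_le' fun _ => h⟩
    have : r x ∈ {β | β < γ → x ∉ B β} := csInf_mem ⟨γ, fun h => absurd h (lt_irrefl γ)⟩
    exact this (h.trans_lt hα) (hanti α hα _ h hx)
  have hlt : ∀ α < γ, ∀ x, α < r x ↔ x ∈ B α := fun α hα x => by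
    rw [← not_le, hle α hα, not_not]
  have hfib : ∀ α < γ, r ⁻¹' {α} = (⋂ β, ⋂ _ : β < α, B β) \ B α := fun α hα => by
    ext x
    change r x = α ↔ x ∈ (⋂ β, ⋂ _ : β < α, B β) ∧ x ∉ B α
    rw [le_antisymm_iff, hle α hα, and_comm, mem_iInter₂]
    refine and_congr_left fun _ => ⟨fun h β hβ => ?_, fun h => ?_⟩
    · exact (hlt β (hβ.trans hα) x).1 (hβ.trans_le h)
    · refine le_of_forall_lt fun β hβ => (hlt β (hβ.trans hα) x).2 (h β hβ)
  have hrp : ∀ x, r x = γ ↔ x = p := fun x => by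
    constructor
    · intro h
      by_contra hxp
      rcases hp {x}ᶜ (isOpen_compl_singleton.mem_nhds (Ne.symm hxp)) with h1 | ⟨β, hβ, hβx⟩
      · exact (h1.symm.subset (mem_univ x)) rfl
      · exact hβx ((hlt β hβ x).1 (h ▸ hβ)) rfl
    · rintro rfl
      refine (hr x).antisymm (le_of_forall_lt fun β hβ => (hlt β hβ x).2 (hpB β hβ))
  have hfibγ : r ⁻¹' {γ} = {p} := ext hrp
  have hrc : Continuous r := by
    refine OrderTopology.continuous_iff.2 fun a => ⟨?_, ?_⟩
    · by_cases ha : a < γ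
      · rw [show r ⁻¹' Ioi a = B a from ext (hlt a ha)]
        exact (hB a ha).2
      · rw [show r ⁻¹' Ioi a = ∅ from
          eq_empty_of_forall_notMem fun x hx => ha (lt_of_lt_of_le hx (hr x))]
        exact isOpen_empty
    · by_cases ha : γ < a
      · rw [show r ⁻¹' Iio a = univ from eq_univ_of_forall fun x => (hr x).trans_lt ha]
        exact isOpen_univ
      · refine isOpen_iff_mem_nhds.2 fun x hx => ?_
        have hxγ : r x < γ := lt_of_lt_of_le hx (not_lt.1 ha)
        refine mem_of_superset ((hB _ hxγ).1.isOpen_compl.mem_nhds ((hle _ hxγ x).1 le_rfl))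
          fun y hy => ?_
        exact ((hle _ hxγ y).2 hy).trans_lt hx
  let π : X → Iic γ := fun x => ⟨r x, hr x⟩
  have hπfib : ∀ y : Iic γ, π ⁻¹' {y} = r ⁻¹' {y.1} := fun y => ext fun x => Subtype.ext_iff
  have hcl : IsClosedMap π := by
    refine isClosedMap_of_forall_fiber fun y U hU hyU => ?_
    rw [hπfib] at hyU
    suffices h : ∃ N ∈ 𝓝 (y : Ordinal.{u}), r ⁻¹' N ⊆ U by
      obtain ⟨N, hN, hNU⟩ := h
      exact ⟨_, continuous_subtype_val.continuousAt.preimage_mem_nhds hN, hNU⟩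
    by_cases hyl : IsSuccLimit (y : Ordinal.{u})
    · rcases (mem_Iic.1 y.2).lt_or_eq with hy | hy
      · rw [hfib _ hy] at hyU
        -- The base property concerns the whole intersection, whereas the fibre omits `B y`; hence
        -- `B y` is added to `U` here and excluded again by the upper end `succ y`.
        obtain ⟨β, hβ, hβU⟩ := hlim _ hy hyl (U ∪ B y) (hU.union (hB _ hy).2) fun x hx => by
          by_cases hxB : x ∈ B y
          · exact Or.inr hxB
          · exact Or.inl (hyU ⟨hx, hxB⟩)
        refine ⟨Ioo β (succ y.1), isOpen_Ioo.mem_nhds ⟨hβ, lt_succ _⟩, fun x hx => ?_⟩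
        exact (hβU ((hlt β (hβ.trans hy) x).1 hx.1)).resolve_right
          ((hle _ hy x).1 (lt_succ_iff.1 hx.2))
      · rw [hy, hfibγ] at hyU
        rcases hp U (hU.mem_nhds (hyU rfl)) with rfl | ⟨β, hβ, hβU⟩
        · exact ⟨univ, univ_mem, subset_univ _⟩
        · exact ⟨Ioi β, isOpen_Ioi.mem_nhds (hβ.trans_eq hy.symm),
            fun x hx => hβU ((hlt β hβ x).1 hx)⟩
    · exact ⟨{y.1}, (SuccOrder.isOpen_singleton_iff.2 hyl).mem_nhds rfl, hyU⟩
  have hs : Function.Surjective π := by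
    rintro ⟨y, hy⟩
    rcases (mem_Iic.1 hy).lt_or_eq with hy' | rfl
    · obtain ⟨x, hx⟩ := hne y hy'
      rw [← hfib y hy'] at hx
      exact ⟨x, Subtype.ext hx⟩
    · exact ⟨p, Subtype.ext ((hrp p).2 rfl)⟩
  have hΔ' : ∀ y, π ⁻¹' {y} ∈ DeltaOmega X := fun y => by
    rw [hπfib]
    rcases (mem_Iic.1 y.2).lt_or_eq with hy | hy
    · rw [hfib _ hy]
      exact hΔ _ hy
    · rw [hy, hfibγ]
      have h1 : IsClopenModuloAt {p} p :=
        ⟨isClosed_singleton, rfl, by rw [Set.sdiff_self]; exact isOpen_empty⟩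
      refine ⟨⟨p, h1⟩, Or.inr ⟨p, rfl, h1, ?_⟩⟩
      refine (isCountablyGenerated_nhds_subtype_iff (mem_singleton p)).2 ?_
      rw [nhdsWithin_singleton]
      infer_instance
  refine ⟨_, isOrdinalDecomposition_range_fiber (hrc.subtype_mk hr) hcl hs fun y => (hΔ' y).1,
    range_subset_iff.2 hΔ', ⟨γ, mem_Iic.2 le_rfl⟩, ?_⟩
  exact (hπfib _).trans hfibγ

/-- Only successor members of the base are sure to be clopen, so the family used is `H (succ β)`.
The classes other than `{p}` are then the complement of `H 1` and the differences `H α \ H (succ α)`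
for `α > 0`. An isolated `p` is handled separately. -/
theorem IsWellOrderableAt.exists_isOrdinalDecomposition [T2Space X] {p : X}
    (h : IsWellOrderableAt p) :
    ∃ 𝓓 : Set (Set X), IsOrdinalDecomposition 𝓓 ∧ 𝓓 ⊆ DeltaOmega X ∧ {p} ∈ 𝓓 := by
  obtain ⟨c, H, rfl | hc, hH⟩ := h
  · have hlt : ∀ α : Ordinal.{u}, α < Cardinal.ord 1 ↔ α = 0 := by simp
    have hsub : ∀ t ∈ 𝓝 p, H 0 ⊆ t := fun t ht => by
      obtain ⟨α, hα, hαt⟩ := hH.hasBasis.mem_iff.1 ht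
      rwa [(hlt α).1 hα] at hαt
    have hp : IsClopen {p} := by
      refine ⟨isClosed_singleton, (isOpen_singleton_iff_nhds_eq_pure p).2
        (le_antisymm (le_pure_iff.2 ?_) (pure_le_nhds p))⟩
      refine mem_of_superset (hH.hasBasis.mem_of_mem ((hlt 0).2 rfl)) fun x hx => ?_
      by_contra hxp
      exact hsub {x}ᶜ (isOpen_compl_singleton.mem_nhds (Ne.symm hxp)) hx rfl
    -- Classes must be nonempty, so a one-point space needs `γ = 0` instead of the split into `{p}ᶜ`
    -- and `{p}`.
    by_cases hX : {p} = (univ : Set X)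
    · refine exists_isOrdinalDecomposition_of_decreasing (γ := 0) (B := fun _ => {p})
        (fun β hβ => absurd hβ not_lt_bot) (fun β hβ => absurd hβ not_lt_bot) (fun U hU => ?_)
        (fun β hβ => absurd hβ not_lt_bot) (fun β hβ => absurd hβ not_lt_bot)
        (fun β hβ => absurd hβ not_lt_bot) (fun β hβ => absurd hβ not_lt_bot)
      left
      exact univ_subset_iff.1 (hX ▸ singleton_subset_iff.2 (mem_of_mem_nhds hU))
    · have hfib : ∀ α < (1 : Ordinal.{u}),
          (⋂ β, ⋂ _ : β < α, ({p} : Set X)) \ {p} = {p}ᶜ := fun α hα => by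
        rw [Order.lt_one_iff.1 hα]
        ext x
        simp
      obtain ⟨x, hx⟩ : ({p}ᶜ : Set X).Nonempty := nonempty_compl.2 hX
      refine exists_isOrdinalDecomposition_of_decreasing (γ := 1) (B := fun _ => {p})
        (fun β hβ => hp) (fun β hβ _ _ => Subset.rfl)
        (fun U hU => Or.inr ⟨0, zero_lt_one, singleton_subset_iff.2 (mem_of_mem_nhds hU)⟩)
        (fun β hβ => rfl) (fun α hα => ?_) (fun α hα => ?_) (fun l hl hlim => ?_)
      · rw [hfib α hα]
        exact ⟨x, hx⟩
      · rw [hfib α hα]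
        exact mem_deltaOmega_of_isClopen hp.compl hx
      · exact absurd (Order.lt_one_iff.1 hl) hlim.bot_lt.ne'
  · have hclim : IsSuccLimit c.ord := Cardinal.isSuccLimit_ord hc.aleph0_le
    have hsucc : ∀ α < c.ord, succ α < c.ord := fun α hα => hclim.succ_lt hα
    have hanti : ∀ β < c.ord, ∀ α ≤ β, H β ⊆ H α := fun β => by
      induction β using WellFoundedLT.induction with
      | ind β ih =>
        intro hβ α hα
        rcases hα.eq_or_lt with rfl | hα
        · exact Subset.rfl
        rcases Ordinal.zero_or_succ_or_isSuccLimit β with rfl | ⟨δ, rfl⟩ | hl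
        · exact absurd hα not_lt_bot
        · exact (hH.ssubset_succ δ hβ).subset.trans
            (ih δ (lt_succ δ) ((lt_succ δ).trans hβ) α (lt_succ_iff.1 hα))
        · exact subset_of_mem_nhdsSet ((hH.hasBasis_limit β hβ hl).mem_of_mem hα)
    have hinter : ∀ α < c.ord, α ≠ 0 → ⋂ β, ⋂ _ : β < α, H (succ β) = H α := fun α hα h0 => by
      refine Subset.antisymm ?_ (subset_iInter₂ fun β hβ => hanti α hα _ (succ_le_of_lt hβ))
      rcases Ordinal.zero_or_succ_or_isSuccLimit α with rfl | ⟨δ, rfl⟩ | hl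
      · exact absurd rfl h0
      · exact fun x hx => mem_iInter₂.1 hx δ (lt_succ δ)
      · intro x hx
        by_contra hxα
        obtain ⟨β, hβ, hβx⟩ := (hH.hasBasis_limit α hα hl).mem_iff.1
          (isOpen_compl_singleton.mem_nhdsSet.2 fun y hy hyx => hxα (hyx ▸ hy) : {x}ᶜ ∈ 𝓝ˢ (H α))
        exact hβx ((hH.ssubset_succ β (hsucc β (hβ.trans hα))).subset (mem_iInter₂.1 hx β hβ)) rfl
    have hne : ∀ α < c.ord, ((⋂ β, ⋂ _ : β < α, H (succ β)) \ H (succ α)).Nonempty :=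
      fun α hα => by
        obtain ⟨x, hx, hx'⟩ := exists_of_ssubset (hH.ssubset_succ α (hsucc α hα))
        exact ⟨x, mem_iInter₂.2 fun β hβ => hanti α hα _ (succ_le_of_lt hβ) hx, hx'⟩
    have hclopen : ∀ α < c.ord, IsClopen (H (succ α)) := fun α hα =>
      hH.isClopen_succ α (hsucc α hα)
    refine exists_isOrdinalDecomposition_of_decreasing (γ := c.ord) (B := fun β => H (succ β))
      hclopen (fun β hβ α hα => hanti _ (hsucc β hβ) _ (succ_le_succ hα)) (fun U hU => ?_)
      (fun β hβ => mem_of_mem_nhds (hH.hasBasis.mem_of_mem (hsucc β hβ))) hne (fun α hα => ?_)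
      (fun l hl hll U hU hlU => ?_)
    · obtain ⟨α, hα, hαU⟩ := hH.hasBasis.mem_iff.1 hU
      exact Or.inr ⟨α, hα, (hanti _ (hsucc α hα) _ (le_succ α)).trans hαU⟩
    · by_cases h0 : α = 0
      · obtain ⟨x, hx⟩ := hne α hα
        refine mem_deltaOmega_of_isClopen ?_ hx
        subst h0
        simpa [← compl_eq_univ_sdiff] using (hclopen 0 hα).compl
      · have h1 := hne α hα
        rw [hinter α hα h0] at h1 ⊢
        exact sdiff_mem_deltaOmega (hH.mem_deltaOmega α hα) (hclopen α hα) h1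
    · rw [hinter l hl hll.bot_lt.ne'] at hlU
      obtain ⟨β, hβ, hβU⟩ := (hH.hasBasis_limit l hl hll).mem_iff.1 (hU.mem_nhdsSet.2 hlU)
      exact ⟨β, hβ, (hanti _ (hsucc β (hβ.trans hl)) _ (le_succ β)).trans hβU⟩

end Decomposition

/-! ### From ordinal decompositions to maximal selections -/

section Maximal

universe u

open Order

variable {X : Type u} [TopologicalSpace X]

/-- A continuous ordinal-valued function that attains its maximum on each nonempty closed set. -/
structure IsOrdinalRank (r : X → Ordinal.{u}) : Prop where
  continuous : Continuous r
  exists_max : ∀ S : Hyperspace X, ∃ x ∈ S.1, ∀ y ∈ S.1, r y ≤ r x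

/-- Upper semi-continuity makes the quotient map closed, so a closed set has compact image in `[0,
γ]` and the maximum is attained. -/
theorem IsOrdinalDecomposition.exists_isOrdinalRank {𝓓 : Set (Set X)}
    (h : IsOrdinalDecomposition 𝓓) :
    ∃ r : X → Ordinal.{u}, IsOrdinalRank r ∧ ∀ x, r ⁻¹' {r x} ∈ 𝓓 := by
  obtain ⟨-, ⟨-, husc⟩, hP, γ, ⟨e⟩⟩ := h
  let q : X → DecompositionSpace 𝓓 hP := Quotient.mk _
  have hq : IsQuotientMap q := isQuotientMap_quotient_mk'
  have hqr : ∀ x y, q x = q y ↔ ∀ s ∈ 𝓓, x ∈ s → y ∈ s := fun x y => Quotient.eq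
  have hcl : IsClosedMap q := fun S hS => by
    refine hq.isClosed_preimage.1 (isOpen_compl_iff.1 (isOpen_iff_mem_nhds.2 fun x hx => ?_))
    obtain ⟨D, ⟨hD, hxD⟩, -⟩ := hP.2 x
    obtain ⟨V, hV, hDV, hVS, 𝓔, h𝓔, rfl⟩ := husc D hD Sᶜ hS.isOpen_compl fun y hy hyS =>
      hx ⟨y, hyS, ((hqr x y).2 fun s hs hxs =>
        Setoid.eq_of_mem_eqv_class hP.2 hD hxD hs hxs ▸ hy).symm⟩
    refine mem_of_superset (hV.mem_nhds (hDV hxD)) ?_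
    rintro y ⟨E, hE, hyE⟩ ⟨s, hsS, hsy⟩
    exact hVS ⟨E, hE, (hqr y s).1 hsy.symm E (h𝓔 hE) hyE⟩ hsS
  have : CompactSpace (Iic γ) := by
    rw [← isCompact_iff_compactSpace, ← Icc_bot]
    exact isCompact_Icc
  have : CompactSpace (DecompositionSpace 𝓓 hP) := e.symm.compactSpace
  have hc : Continuous fun z => (e z : Ordinal.{u}) := continuous_subtype_val.comp e.continuous
  refine ⟨fun x => e (q x), ⟨hc.comp hq.continuous, fun S => ?_⟩, fun x => ?_⟩
  · obtain ⟨_, ⟨x, hx, rfl⟩, hmax⟩ :=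
      (hcl _ S.2.2).isCompact.exists_isMaxOn (S.2.1.image q) hc.continuousOn
    exact ⟨x, hx, fun y hy => hmax (mem_image_of_mem q hy)⟩
  · convert! Setoid.eqv_class_mem hP.2 (y := x) using 1
    ext y
    exact (Subtype.ext_iff.symm.trans e.injective.eq_iff).trans Quotient.eq

namespace IsOrdinalRank

variable {r : X → Ordinal.{u}}

theorem isClopen_le (hr : IsOrdinalRank r) (α : Ordinal.{u}) : IsClopen {x | r x ≤ α} :=
  ⟨isClosed_Iic.preimage hr.continuous, by
    rw [show {x | r x ≤ α} = r ⁻¹' Iio (succ α) from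
      ext fun x => (lt_succ_iff (a := r x)).symm]
    exact isOpen_Iio.preimage hr.continuous⟩

/-- The points of rank at most `α` outside `U` have a largest rank, which is below `α`; `V` consists
of the points of larger rank. -/
theorem exists_isClopen (hr : IsOrdinalRank r) {α : Ordinal.{u}} {U : Set X} (hU : IsOpen U)
    (hα : r ⁻¹' {α} ⊆ U) :
    ∃ V, IsClopen V ∧ (∀ x y, x ∈ V → r x ≤ r y → y ∈ V) ∧ r ⁻¹' {α} ⊆ V ∧
      ∀ x ∈ V, r x ≤ α → x ∈ U := by
  rcases (Uᶜ ∩ {x | r x ≤ α}).eq_empty_or_nonempty with h | h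
  · refine ⟨univ, isClopen_univ, fun _ _ _ _ => trivial, subset_univ _, fun x _ hx => ?_⟩
    by_contra hxU
    exact h.subset ⟨hxU, hx⟩
  · obtain ⟨z, ⟨hzU, hzα⟩, hz⟩ := hr.exists_max
      ⟨_, h, hU.isClosed_compl.inter (hr.isClopen_le α).1⟩
    have hzα' : r z < α := lt_of_le_of_ne hzα fun h => hzU (hα h)
    refine ⟨{x | r x ≤ r z}ᶜ, (hr.isClopen_le _).compl, fun x y hx hxy hy => hx (hxy.trans hy),
      fun x hx => ?_, fun x hx hxα => ?_⟩
    · rw [show α = r x from hx.symm] at hzα'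
      exact hzα'.not_ge
    · by_contra hxU
      exact hx (hz x ⟨hxU, hxα⟩)

end IsOrdinalRank

/-- A member of `Δ_ω(X)` in a zero-dimensional space is, up to one point, exhausted by clopen
sets. -/
theorem exists_isClopen_exhaustion [T1Space X] {D : Set X} (hD : D ∈ DeltaOmega X)
    (hz : ∀ p : X, ∀ U ∈ 𝓝 p, ∃ C, IsClopen C ∧ p ∈ C ∧ C ⊆ U) :
    ∃ A : ℕ → Set X, (∀ n, IsClopen (A n)) ∧ (∀ n, A n ⊆ D) ∧
      ∀ x ∈ D, (∀ n, x ∉ A n) → IsOpen (D \ {x}) ∧ ∀ W ∈ 𝓝 x, ∃ n, D \ W ⊆ A n := by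
  obtain ⟨-, h | ⟨q, hq, ⟨hDc, -, hDq⟩, hcg⟩⟩ := hD
  · exact ⟨fun _ => D, fun _ => h, fun _ => Subset.rfl, fun x hx hx' => absurd hx (hx' 0)⟩
  rw [isCountablyGenerated_nhds_subtype_iff] at hcg
  obtain ⟨V, hV⟩ := (𝓝[D] q).exists_antitone_basis
  have h1 : ∀ n, ∃ C, IsClopen C ∧ q ∈ C ∧ C ∩ D ⊆ V n := fun n => by
    obtain ⟨u, hu, huV⟩ := mem_nhdsWithin_iff_exists_mem_nhds_inter.1 (hV.1.mem_of_mem trivial)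
    obtain ⟨C, hC, hqC, hCu⟩ := hz q u hu
    exact ⟨C, hC, hqC, (inter_subset_inter_left _ hCu).trans huV⟩
  choose C hC hqC hCV using h1
  have hshrink : ∀ W ∈ 𝓝 q, ∃ n, D \ W ⊆ D \ C n := fun W hW => by
    obtain ⟨n, -, hn⟩ := hV.1.mem_iff.1 (mem_nhdsWithin_of_mem_nhds hW)
    exact ⟨n, fun x hx => ⟨hx.1, fun hxC => hx.2 (hn (hCV n ⟨hxC, hx.1⟩))⟩⟩
  refine ⟨fun n => D \ C n, fun n => ⟨hDc.sdiff (hC n).2, ?_⟩, fun n => sdiff_subset,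
    fun x hx hxC => ?_⟩
  · have : D \ C n = (D \ {q}) \ C n := by
      ext y
      exact ⟨fun h => ⟨⟨h.1, fun hy => h.2 (hy ▸ hqC n)⟩, h.2⟩, fun h => ⟨h.1.1, h.2⟩⟩
    change IsOpen (D \ C n)
    rw [this]
    exact hDq.sdiff (hC n).1
  · obtain rfl : x = q := by
      by_contra hxq
      obtain ⟨n, hn⟩ := hshrink {x}ᶜ (isOpen_compl_singleton.mem_nhds (Ne.symm hxq))
      exact hxC n (hn ⟨hx, fun h => h rfl⟩)
    exact ⟨hDq, hshrink⟩

/-- Selecting from the part of maximal rank. -/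
theorem IsOrdinalRank.exists_isContinuousSelection [T1Space X] {r : X → Ordinal.{u}}
    (hr : IsOrdinalRank r) (hΔ : ∀ x, r ⁻¹' {r x} ∈ DeltaOmega X)
    (hz : ∀ p : X, ∀ U ∈ 𝓝 p, ∃ C, IsClopen C ∧ p ∈ C ∧ C ⊆ U)
    {h : Hyperspace X → X} (hh : IsContinuousSelection h) :
    ∃ f : Hyperspace X → X, IsContinuousSelection f ∧ ∀ S : Hyperspace X, ∀ y ∈ S.1,
      r y ≤ r (f S) := by
  classical
  have hA : ∀ α, ∃ A : ℕ → Set X, (∀ n, IsClopen (A n)) ∧ (∀ n, A n ⊆ r ⁻¹' {α}) ∧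
      ∀ x ∈ r ⁻¹' {α}, (∀ n, x ∉ A n) →
        IsOpen (r ⁻¹' {α} \ {x}) ∧ ∀ W ∈ 𝓝 x, ∃ n, r ⁻¹' {α} \ W ⊆ A n := fun α => by
    by_cases hα : ∃ x, r x = α
    · obtain ⟨x, rfl⟩ := hα
      exact exists_isClopen_exhaustion (hΔ x) hz
    · exact ⟨fun _ => ∅, fun _ => isClopen_empty, fun _ => empty_subset _,
        fun x hx => absurd ⟨x, hx⟩ hα⟩
  choose A hAc hAr hAx using hA
  choose M hMS hM using hr.exists_max
  let F : Ordinal.{u} → ℕ → Hyperspace X → X := fun α n S => h (trace (A α n) (hAc α n).1 S)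
  -- If `S` meets no `A (r (M S)) n`, its top part is the single exceptional point of that class, so
  -- `M S` is no arbitrary choice.
  let f : Hyperspace X → X := fun S =>
    if hS : ∃ n, (S.1 ∩ A (r (M S)) n).Nonempty then F (r (M S)) (Nat.find hS) S else M S
  have hf1 : ∀ (S : Hyperspace X) α n, r (M S) = α → (S.1 ∩ A α n).Nonempty →
      (∀ j < n, ¬ (S.1 ∩ A α j).Nonempty) → f S = F α n S := by
    rintro S _ n rfl hn hj
    have hS : ∃ n, (S.1 ∩ A (r (M S)) n).Nonempty := ⟨n, hn⟩
    rw [show f S = F (r (M S)) (Nat.find hS) S from dif_pos hS, (Nat.find_eq_iff hS).2 ⟨hn, hj⟩]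
  have hF : ∀ (S : Hyperspace X) α n, (S.1 ∩ A α n).Nonempty → F α n S ∈ S.1 ∩ A α n :=
    fun S α n hS => by
      have h1 : F α n S ∈ (trace (A α n) (hAc α n).1 S).1 := hh.2 _
      rwa [trace_val _ hS] at h1
  have hf : ∀ S : Hyperspace X, f S ∈ S.1 ∧ r (f S) = r (M S) := fun S => by
    by_cases hS : ∃ n, (S.1 ∩ A (r (M S)) n).Nonempty
    · rw [show f S = F (r (M S)) (Nat.find hS) S from dif_pos hS]
      have h1 := hF S _ _ (Nat.find_spec hS)
      exact ⟨h1.1, hAr _ _ h1.2⟩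
    · rw [show f S = M S from dif_neg hS]
      exact ⟨hMS S, rfl⟩
  refine ⟨f, ⟨continuous_iff_continuousAt.2 fun S => ?_, fun S => (hf S).1⟩, fun S y hy => ?_⟩
  swap
  · rw [(hf S).2]
    exact hM S y hy
  have hle : ∀ᶠ T : Hyperspace X in 𝓝 S, r (M T) ≤ r (M S) := by
    filter_upwards [(isOpen_subset (hr.isClopen_le (r (M S))).2).mem_nhds fun y hy => hM S y hy]
      with T hT
    exact hT (hMS T)
  have havoid : ∀ n, ¬ (S.1 ∩ A (r (M S)) n).Nonempty →
      ∀ᶠ T : Hyperspace X in 𝓝 S, ¬ (T.1 ∩ A (r (M S)) n).Nonempty := fun n hn => by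
    filter_upwards [(isOpen_subset (hAc (r (M S)) n).1.isOpen_compl).mem_nhds
      fun y hy hyA => hn ⟨y, hy, hyA⟩] with T hT
    rintro ⟨y, hy, hyA⟩
    exact hT hy hyA
  by_cases hS : ∃ n, (S.1 ∩ A (r (M S)) n).Nonempty
  · set n := Nat.find hS with hn
    have hSn := Nat.find_spec hS
    have h1 : ∀ᶠ T : Hyperspace X in 𝓝 S, (T.1 ∩ A (r (M S)) n).Nonempty :=
      (isOpen_meets (hAc _ n).2).mem_nhds hSn
    have h2 : ∀ᶠ T : Hyperspace X in 𝓝 S, ∀ j < n, ¬ (T.1 ∩ A (r (M S)) j).Nonempty :=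
      (eventually_all_finite (Set.finite_lt_nat n)).2 fun j hj => havoid j (Nat.find_min hS hj)
    -- Near `S` neither the maximal rank nor the first clopen set met changes.
    have h3 : f =ᶠ[𝓝 S] F (r (M S)) n := by
      filter_upwards [hle, h1, h2] with T hT1 hT2 hT3
      refine hf1 T _ n (hT1.antisymm ?_) hT2 hT3
      obtain ⟨y, hyT, hyA⟩ := hT2
      exact (hAr _ n hyA : r y = r (M S)).symm.le.trans (hM T y hyT)
    exact (hh.1.comp (continuous_trace (hAc _ n))).continuousAt.congr h3.symm
  · have hfS : f S = M S := dif_neg hS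
    obtain ⟨hDopen, hDsh⟩ := hAx (r (M S)) (M S) rfl fun n hn => hS ⟨n, M S, hMS S, hn⟩
    rw [ContinuousAt, hfS]
    refine tendsto_def.2 fun W' hW' => ?_
    obtain ⟨W, hWW', hW, hMW⟩ := mem_nhds_iff.1 hW'
    -- Sets `T` near `S` miss this `A (r (M S)) n`, so a value in the top class must lie in `W`. A
    -- value in a lower class is forced into `W` by the upper set `V`, which `T` meets.
    obtain ⟨n, hn⟩ := hDsh W (hW.mem_nhds hMW)
    obtain ⟨V, hV, hVup, hDV, hVU⟩ := hr.exists_isClopen (α := r (M S)) (hW.union hDopen)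
      fun x hx => by
        by_cases hxM : x = M S
        · exact Or.inl (hxM ▸ hMW)
        · exact Or.inr ⟨hx, hxM⟩
    have h1 : ∀ᶠ T : Hyperspace X in 𝓝 S, (T.1 ∩ V).Nonempty :=
      (isOpen_meets hV.2).mem_nhds ⟨M S, hMS S, hDV rfl⟩
    filter_upwards [hle, h1, havoid n fun h => hS ⟨n, h⟩] with T hT1 hT2 hT3
    obtain ⟨t, htT, htV⟩ := hT2
    obtain ⟨hfT, hrf⟩ := hf T
    have hfV : f T ∈ V := hVup t _ htV (hrf ▸ hM T t htT)
    refine hWW' ((hVU _ hfV (hrf.trans_le hT1)).elim id fun hD => ?_)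
    by_contra hfW
    exact hT3 ⟨f T, hfT, hn ⟨hD.1, hfW⟩⟩

/-- Ordinal decompositions in `Δ_ω(X)` having the singletons as members give maximal selections. -/
theorem selectionPointwiseMaximal_of_isOrdinalDecomposition [T2Space X]
    (hsel : ∃ f : Hyperspace X → X, IsContinuousSelection f)
    (hX : ∀ p : X, ∃ 𝓓 : Set (Set X), IsOrdinalDecomposition 𝓓 ∧ 𝓓 ⊆ DeltaOmega X ∧ {p} ∈ 𝓓) :
    SelectionPointwiseMaximal X := by
  have hX' : ∀ p : X, ∃ r : X → Ordinal.{u}, IsOrdinalRank r ∧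
      (∀ x, r ⁻¹' {r x} ∈ DeltaOmega X) ∧ r ⁻¹' {r p} = {p} := fun p => by
    obtain ⟨𝓓, h𝓓, hΔ, hp⟩ := hX p
    obtain ⟨r, hr, hr𝓓⟩ := h𝓓.exists_isOrdinalRank
    exact ⟨r, hr, fun x => hΔ (hr𝓓 x),
      Setoid.eq_of_mem_eqv_class h𝓓.2.1.1.2 (hr𝓓 p) rfl hp (mem_singleton p)⟩
  have hz : ∀ p : X, ∀ U ∈ 𝓝 p, ∃ C, IsClopen C ∧ p ∈ C ∧ C ⊆ U := fun p U hU => by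
    obtain ⟨r, hr, -, hrp⟩ := hX' p
    obtain ⟨V, hV, -, hpV, hVU⟩ := hr.exists_isClopen (α := r p) (U := interior U) isOpen_interior
      (hrp ▸ singleton_subset_iff.2 (mem_interior_iff_mem_nhds.2 hU))
    exact ⟨V ∩ {x | r x ≤ r p}, hV.inter (hr.isClopen_le _), ⟨hpV rfl, le_refl (r p)⟩,
      fun x hx => interior_subset (hVU x hx.1 hx.2)⟩
  intro p
  obtain ⟨h, hh⟩ := hsel
  obtain ⟨r, hr, hΔ, hrp⟩ := hX' p
  obtain ⟨f, hf, hfr⟩ := hr.exists_isContinuousSelection hΔ hz hh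
  have hC := hr.isClopen_le (r p)
  -- On sets containing `p`, the trace has top rank `r p`, whose class is `{p}`.
  refine ⟨fun S => f (trace _ hC.1 S), ⟨hf.1.comp (continuous_trace hC),
    fun S => trace_subset hC.1 S (hf.2 _)⟩, fun S hpS => ?_⟩
  have hT := trace_val hC.1 (S := S) ⟨p, hpS, le_refl (r p)⟩
  have h1 := hf.2 (trace _ hC.1 S)
  have h2 := hfr (trace _ hC.1 S) p (by rw [hT]; exact ⟨hpS, le_refl (r p)⟩)
  rw [hT] at h1
  exact hrp.subset (le_antisymm h1.2 h2)

end Maximal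

end OrdDec

theorem theorem5p4 (X : Type*) [TopologicalSpace X] [T2Space X]
    (hsel : ∃ f : OrdDec.Hyperspace X → X, OrdDec.IsContinuousSelection f) :
    List.TFAE
      [OrdDec.SelectionPointwiseMaximal X,
       OrdDec.PointwiseWellOrderable X,
       ∀ p : X, ∃ 𝓓 : Set (Set X), OrdDec.IsOrdinalDecomposition 𝓓 ∧
         𝓓 ⊆ OrdDec.DeltaOmega X ∧ {p} ∈ 𝓓] := by
  tfae_have 1 → 2 := fun h => h.pointwiseWellOrderable
  tfae_have 2 → 3 := fun h p => (h p).exists_isOrdinalDecomposition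
  tfae_have 3 → 1 := OrdDec.selectionPointwiseMaximal_of_isOrdinalDecomposition hsel
  tfae_finish
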